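/- Let $H$ be a complex Hilbert space and let $\mathcal N$ be a complete nest in $B(H)$, that is, a totally ordered complete sublattice of the lattice of projections of $B(H)$ containing $0$ and $I$; write $P^\perp=I-P$. Let $\mathcal T(\mathcal N)=\{T\in B(H): P^\perp TP=0 \text{ for all } P\in\mathcal N\}$ be the nest algebra and $\mathcal D(\mathcal N)=\mathcal T(\mathcal N)\cap\mathcal T(\mathcal N)^*$ its diagonal. "Weakly closed", "$\overline{\mathrm{span}}^w$" refer to the weak operator topology. A subspace $\mathcal M\subseteq B(H)$ is a $\mathcal T(\mathcal N)$-bimodule if $\mathcal M\,\mathcal T(\mathcal N)\subseteq\mathcal M$ and $\mathcal T(\mathcal N)\,\mathcal M\subseteq\mathcal M$, and a Lie $\mathcal T(\mathcal N)$-module if $[\mathcal M,\mathcal T(\mathcal N)]\subseteq\mathcal M$. For $z\in H$ put $P_z=\bigwedge\{Q\in\mathcal N:Qz=z\}$ and $\hat P_z=\bigvee\{Q\in\mathcal N:Qz=0\}$, and let $x\otimes y$ be the operator $z\mapsto\langle z,x\rangle y$. For a Lie $\mathcal T(\mathcal N)$-module $\mathcal L$ let $$\mathcal J(\mathcal L)=\overline{\mathrm{span}}^w\{x\otimes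 y: P_y B(H)\hat P_x^\perp\subseteq\mathcal L\},$$ and let $\mathcal K(\mathcal L)=\mathcal K_V+\mathcal K_L+\mathcal K_D+\mathcal K_\Delta$, where $$\mathcal K_V=\overline{\mathrm{span}}^w\{PTP^\perp\},\quad \mathcal K_L=\overline{\mathrm{span}}^w\{P^\perp TP\},\quad \mathcal K_D=\overline{\mathrm{span}}^w\{PSP^\perp TP\},\quad \mathcal K_\Delta=\overline{\mathrm{span}}^w\{P^\perp TPSP^\perp\},$$ with $P$ ranging over $\mathcal N$, $T$ over $\mathcal L$ and $S$ over $\mathcal T(\mathcal N)$. A map $\phi:\mathcal N\to\mathcal N$ preserving arbitrary suprema (a left order continuous homomorphism) is associated with a subspace $\mathcal M$ of $B(H)$ if $\mathcal M=\{T\in B(H):\phi(P)^\perp TP=0 \text{ for all } P\in\mathcal N\}$. For such a $\phi$ associated with $\mathcal K(\mathcal L)$, let $\mathcal D_{\mathcal K(\mathcal L)}$ be the set of all $T\in\mathcal D(\mathcal N)$ such that, for every $P\in\mathcal N$ with $\phi(P)<P_-:=\bigvee\{Q\in\mathcal N:Q<P\}$, there is $\lambda_P\in\mathbb C$ with $T(P-\phi(P))=\lambda_P(P-\phi(P))$.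 Theorem. Let $\mathcal L$ be a weakly closed Lie $\mathcal T(\mathcal N)$-module. Then $\mathcal J(\mathcal L)$ and $\mathcal K(\mathcal L)$ are weakly closed $\mathcal T(\mathcal N)$-bimodules; there is a left order continuous homomorphism $\phi$ associated with $\mathcal K(\mathcal L)$; for every such $\phi$ the set $\mathcal D_{\mathcal K(\mathcal L)}$ is a von Neumann subalgebra of $\mathcal D(\mathcal N)$; and $$\mathcal J(\mathcal L)\subseteq\mathcal L\subseteq\mathcal K(\mathcal L)+\mathcal D_{\mathcal K(\mathcal L)}.$$ Moreover, $$\mathcal J(\mathcal L)=\overline{\mathrm{span}}^w\bigl(\{QB(H)P^\perp: P,Q\in\mathcal N,\ QB(H)P^\perp\subseteq\mathcal L\}\bigr)$$ is the largest weakly closed $\mathcal T(\mathcal N)$-bimodule contained in $\mathcal L$, and $[\mathcal K(\mathcal L),\mathcal T(\mathcal N)]\subseteq\mathcal L$. -/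

import Mathlib

noncomputable section

namespace NestAlg

/-- A subspace of `B(H)` is weakly closed if it is closed in the weak operator topology. -/
def IsWeaklyClosed {H : Type*} [NormedAddCommGroup H] [InnerProductSpace ℂ H]
    (M : Submodule ℂ (H →L[ℂ] H)) : Prop :=
  IsClosed {A : H →WOT[ℂ] H | A.toCLM ∈ M}

/-- The closure of the linear span of `X` in the weak operator topology. -/
def wspan {H : Type*} [NormedAddCommGroup H] [InnerProductSpace ℂ H]
    (X : Set (H →L[ℂ] H)) : Submodule ℂ (H →L[ℂ] H) :=
  (((Submodule.span ℂ X).comap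
      (ContinuousLinearMapWOT.linearEquiv (σ := RingHom.id ℂ) (E := H) (F := H) ℂ).toLinearMap).topologicalClosure).map
    (ContinuousLinearMapWOT.linearEquiv (σ := RingHom.id ℂ) (E := H) (F := H) ℂ).toLinearMap

section
variable {H : Type*} [NormedAddCommGroup H] [InnerProductSpace ℂ H] [CompleteSpace H]

/-- The orthogonal projection onto a closed subspace. -/
def proj (P : ClosedSubmodule ℂ H) : H →L[ℂ] H := P.toSubmodule.starProjection

/-- The complementary projection `P^⊥ = I - P`. -/
def coproj (P : ClosedSubmodule ℂ H) : H →L[ℂ] H := 1 - proj P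

/-- A complete nest: projections are identified with their ranges, so a complete nest is a totally
ordered complete sublattice of the lattice of closed subspaces. (A complete sublattice contains
the suprema and infima of all its subsets, in particular `0` and the whole space.) -/
def IsNest (N : CompleteSublattice (ClosedSubmodule ℂ H)) : Prop :=
  IsChain (· ≤ ·) (N : Set (ClosedSubmodule ℂ H))

/-- The nest algebra: all operators leaving every element of the nest invariant. -/
def nestAlgebra (N : CompleteSublattice (ClosedSubmodule ℂ H)) : Subalgebra ℂ (H →L[ℂ] H) where
  carrier := {T | ∀ P ∈ N, ∀ x ∈ P, T x ∈ P}
  mul_mem' := fun {_ _} hS hT P hP x hx => hS P hP _ (hT P hP x hx)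
  add_mem' := fun {_ _} hS hT P hP x hx => add_mem (hS P hP x hx) (hT P hP x hx)
  algebraMap_mem' := fun c P _ x hx => by
    simpa [Algebra.algebraMap_eq_smul_one] using P.toSubmodule.smul_mem c hx

/-- The diagonal `T(N) ∩ T(N)*` of the nest algebra. -/
def diagonal (N : CompleteSublattice (ClosedSubmodule ℂ H)) : Set (H →L[ℂ] H) :=
  {T | T ∈ nestAlgebra N ∧ star T ∈ nestAlgebra N}

/-- `M T(N) ⊆ M` and `T(N) M ⊆ M`. -/
def IsBimodule (N : CompleteSublattice (ClosedSubmodule ℂ H))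
    (M : Submodule ℂ (H →L[ℂ] H)) : Prop :=
  ∀ T ∈ M, ∀ S ∈ nestAlgebra N, T * S ∈ M ∧ S * T ∈ M

/-- `[M, T(N)] ⊆ M`. -/
def IsLieModule (N : CompleteSublattice (ClosedSubmodule ℂ H))
    (M : Submodule ℂ (H →L[ℂ] H)) : Prop :=
  ∀ T ∈ M, ∀ S ∈ nestAlgebra N, T * S - S * T ∈ M

/-- `P_z = ⋀ {Q ∈ N : Q z = z}`. -/
def lowerProj (N : CompleteSublattice (ClosedSubmodule ℂ H)) (z : H) : N :=
  sInf {Q : N | proj (Q : ClosedSubmodule ℂ H) z = z}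

/-- `\hat P_z = ⋁ {Q ∈ N : Q z = 0}`. -/
def upperProj (N : CompleteSublattice (ClosedSubmodule ℂ H)) (z : H) : N :=
  sSup {Q : N | proj (Q : ClosedSubmodule ℂ H) z = 0}

/-- The set `C(M)` of operators `x ⊗ y : z ↦ ⟨z, x⟩ y` with `P_y B(H) \hat P_x^⊥ ⊆ M`. -/
def rankOneSet (N : CompleteSublattice (ClosedSubmodule ℂ H))
    (M : Submodule ℂ (H →L[ℂ] H)) : Set (H →L[ℂ] H) :=
  {A | ∃ x y : H, A = InnerProductSpace.rankOne ℂ y x ∧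
    ∀ T : H →L[ℂ] H,
      proj (lowerProj N y : ClosedSubmodule ℂ H) * T *
        coproj (upperProj N x : ClosedSubmodule ℂ H) ∈ M}

/-- `J(M)`, the weakly closed span of `C(M)`. -/
def bimodJ (N : CompleteSublattice (ClosedSubmodule ℂ H))
    (M : Submodule ℂ (H →L[ℂ] H)) : Submodule ℂ (H →L[ℂ] H) :=
  wspan (rankOneSet N M)

/-- The union of all the spaces `Q B(H) P^⊥`, `P, Q ∈ N`, which are contained in `M`. -/
def cornerSet (N : CompleteSublattice (ClosedSubmodule ℂ H))
    (M : Submodule ℂ (H →L[ℂ] H)) : Set (H →L[ℂ] H) :=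
  {A | ∃ P ∈ N, ∃ Q ∈ N, (∀ T : H →L[ℂ] H, proj Q * T * coproj P ∈ M) ∧
    ∃ T : H →L[ℂ] H, A = proj Q * T * coproj P}

/-- The weakly closed span of the operators `P T P^⊥`, `P ∈ N`, `T ∈ L`. -/
def bimodKV (N : CompleteSublattice (ClosedSubmodule ℂ H))
    (L : Submodule ℂ (H →L[ℂ] H)) : Submodule ℂ (H →L[ℂ] H) :=
  wspan {A | ∃ P ∈ N, ∃ T ∈ L, A = proj P * T * coproj P}

/-- The weakly closed span of the operators `P^⊥ T P`, `P ∈ N`, `T ∈ L`. -/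
def bimodKL (N : CompleteSublattice (ClosedSubmodule ℂ H))
    (L : Submodule ℂ (H →L[ℂ] H)) : Submodule ℂ (H →L[ℂ] H) :=
  wspan {A | ∃ P ∈ N, ∃ T ∈ L, A = coproj P * T * proj P}

/-- The weakly closed span of the operators `P S P^⊥ T P`, `P ∈ N`, `T ∈ L`, `S ∈ T(N)`. -/
def bimodKD (N : CompleteSublattice (ClosedSubmodule ℂ H))
    (L : Submodule ℂ (H →L[ℂ] H)) : Submodule ℂ (H →L[ℂ] H) :=
  wspan {A | ∃ P ∈ N, ∃ T ∈ L, ∃ S ∈ nestAlgebra N,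
    A = proj P * S * coproj P * T * proj P}

/-- The weakly closed span of the operators `P^⊥ T P S P^⊥`, `P ∈ N`, `T ∈ L`, `S ∈ T(N)`. -/
def bimodKDelta (N : CompleteSublattice (ClosedSubmodule ℂ H))
    (L : Submodule ℂ (H →L[ℂ] H)) : Submodule ℂ (H →L[ℂ] H) :=
  wspan {A | ∃ P ∈ N, ∃ T ∈ L, ∃ S ∈ nestAlgebra N,
    A = coproj P * T * proj P * S * coproj P}

/-- `K(L)`, the (algebraic) sum of the four spaces above. -/
def bimodK (N : CompleteSublattice (ClosedSubmodule ℂ H))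
    (L : Submodule ℂ (H →L[ℂ] H)) : Submodule ℂ (H →L[ℂ] H) :=
  bimodKV N L ⊔ bimodKL N L ⊔ bimodKD N L ⊔ bimodKDelta N L

/-- The left order continuous homomorphism `φ : N → N` (a map preserving arbitrary suprema) is
associated with `M`: `M = {T : φ(P)^⊥ T P = 0 for all P ∈ N}`. -/
def IsAssociated (N : CompleteSublattice (ClosedSubmodule ℂ H)) (φ : sSupHom N N)
    (M : Submodule ℂ (H →L[ℂ] H)) : Prop :=
  ∀ T : H →L[ℂ] H, T ∈ M ↔
    ∀ P : N, coproj (φ P : ClosedSubmodule ℂ H) * T * proj (P : ClosedSubmodule ℂ H) = 0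

/-- `P_- = ⋁ {Q ∈ N : Q < P}`. -/
def pred (N : CompleteSublattice (ClosedSubmodule ℂ H)) (P : N) : N := sSup {Q : N | Q < P}

/-- The set `D_K`, where `φ` is associated with `K`: all `T` in the diagonal such that, for every
`P ∈ N` with `φ(P) < P_-`, `T (P - φ(P))` is a scalar multiple of `P - φ(P)`. -/
def diagD (N : CompleteSublattice (ClosedSubmodule ℂ H)) (φ : sSupHom N N) :
    Set (H →L[ℂ] H) :=
  {T | T ∈ diagonal N ∧ ∀ P : N, φ P < pred N P → ∃ c : ℂ,
    T * (proj (P : ClosedSubmodule ℂ H) - proj (φ P : ClosedSubmodule ℂ H)) =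
      c • (proj (P : ClosedSubmodule ℂ H) - proj (φ P : ClosedSubmodule ℂ H))}

end

end NestAlg

end

/-!
The argument is operator theoretic and rests on two facts about a nest `N` with nest algebra `T(N)`.
The first is reflexivity (`IsNest.mem_of_invariant`): a closed subspace invariant under `T(N)` belongs
to `N`. The second is the Erdos density theorem (`IsNest.one_mem_wspan_nestRankOnes`): the identity is
a weak limit of sums of rank one operators of `T(N)`. Weak limits are handled by duality: only
finitely many matrix coefficients matter at a time, so an operator lies in a weakly closed space when
every finite rank functional annihilating the space annihilates the operator. For the density theorem
the functional is `A ↦ tr (F A)` with `F` of finite rank mapping each `P ∈ N` into `P_-`, and such an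
`F` is nilpotent. As a consequence a weakly closed bimodule is generated by its rank one operators.
This gives the statements on `J(L)` and the homomorphism `φ` associated with a weakly closed bimodule
`M`: `φ(P)` is the closed span of `M P`.

For the Lie module `L` itself, `[T, P]` and `[[T, P], P]` show that `P T P^⊥` and `P^⊥ T P` are in
`L`; and if `t = P^⊥ T P ≠ 0`, the identity `[[t, s], s] = -2 s t s` for rank one `s = P s P^⊥` forces
`P B(H) P^⊥ ⊆ L` (`IsLieModule.corner_mem`). Direct computation with the generators then shows
`[K(L), T(N)] ⊆ L` and that the weak closure of `K(L)` is a bimodule.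

The delicate point is that the algebraic sum `K(L)` is weakly closed
(`IsLieModule.bimodKClosure_le`), since triangular truncation is unbounded. Let `M` be the closure of
`K(L)`. Off-diagonal corners of `M` are corners of `L` up to weak limits. For `P ∈ N` let the edge of
`P` be the largest `Q ∈ N` with `M Q ⊆ P`. The projection `X` onto the span of all intervals from the
edge of `P` to `P` commutes with `N`. For `A ∈ M` the operator `A X^⊥` is upper triangular; its
diagonal blocks at atoms form a bounded block diagonal operator in `K_Δ`, and the rest lies in `K_V`.
In `A X` the only part not in `K_D` sits in the rows of atoms touching the edge of `M`; these blocks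
have pairwise orthogonal rows and pairwise orthogonal columns, so their sum is bounded, and it lies in
`K_L`.

Finally, for `T ∈ L` all commutators `[T, P]` are in `K(L)`, so averaging `T` over the symmetries
`2 P - 1` and passing to a weak limit produces `B` in the diagonal with `T - B ∈ K(L)`. Then
`[B, T(N)] ⊆ L`, which forces `B` to be a scalar on `P - φ(P)` whenever `N` has an element strictly
between `φ(P)` and `P`.
-/

noncomputable section

namespace NestAlg

open scoped InnerProductSpace Topology
open InnerProductSpace Filter

set_option linter.unusedSectionVars false

variable {H : Type*} [NormedAddCommGroup H] [InnerProductSpace ℂ H]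

/-! ### Weakly closed spaces of operators -/

lemma mem_wspan_iff {X : Set (H →L[ℂ] H)} {A : H →L[ℂ] H} :
    A ∈ wspan X ↔ ContinuousLinearMapWOT.ofCLM A ∈
      ((Submodule.span ℂ X).comap (ContinuousLinearMapWOT.linearEquiv (σ := RingHom.id ℂ)
        (E := H) (F := H) ℂ).toLinearMap).topologicalClosure := by
  constructor
  · rintro ⟨B, hB, rfl⟩
    exact hB
  · intro h
    exact ⟨_, h, rfl⟩

lemma isWeaklyClosed_wspan (X : Set (H →L[ℂ] H)) : IsWeaklyClosed (wspan X) := by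
  simp only [IsWeaklyClosed, mem_wspan_iff]
  exact Submodule.isClosed_topologicalClosure _

lemma subset_wspan (X : Set (H →L[ℂ] H)) : X ⊆ wspan X := fun A hA => by
  rw [SetLike.mem_coe, mem_wspan_iff]
  exact Submodule.le_topologicalClosure _ (Submodule.subset_span (s := X) hA)

lemma wspan_le {X : Set (H →L[ℂ] H)} {M : Submodule ℂ (H →L[ℂ] H)} (hM : IsWeaklyClosed M)
    (h : X ⊆ M) : wspan X ≤ M := fun A hA => by
  rw [mem_wspan_iff] at hA
  have := Submodule.topologicalClosure_minimal _ (t := M.comap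
    (ContinuousLinearMapWOT.linearEquiv (σ := RingHom.id ℂ) (E := H) (F := H) ℂ).toLinearMap)
    (Submodule.comap_mono (Submodule.span_le.2 h)) hM
  exact this hA

lemma wspan_mono {X Y : Set (H →L[ℂ] H)} (h : X ⊆ Y) : wspan X ≤ wspan Y :=
  wspan_le (isWeaklyClosed_wspan Y) (h.trans (subset_wspan Y))

lemma isWeaklyClosed_bot : IsWeaklyClosed (⊥ : Submodule ℂ (H →L[ℂ] H)) := by
  have : {A : H →WOT[ℂ] H | A.toCLM ∈ (⊥ : Submodule ℂ (H →L[ℂ] H))} = {0} := by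
    ext A
    simp only [Submodule.mem_bot, Set.mem_ofPred_eq, Set.mem_singleton_iff]
    exact ⟨fun h => ContinuousLinearMapWOT.toCLM_injective h, fun h => by rw [h]; rfl⟩
  rw [IsWeaklyClosed, this]
  exact isClosed_singleton

lemma continuous_inner_apply_wot [CompleteSpace H] (x y : H) :
    Continuous fun A : H →WOT[ℂ] H => ⟪y, A.toCLM x⟫_ℂ :=
  ContinuousLinearMapWOT.continuous_inner_apply continuous_id x y

/-- The preimage of a weakly closed space under a linear map that is continuous for the weak
operator topology. -/
lemma IsWeaklyClosed.comap [CompleteSpace H] {M : Submodule ℂ (H →L[ℂ] H)}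
    (hM : IsWeaklyClosed M) (Φ : (H →L[ℂ] H) →ₗ[ℂ] (H →L[ℂ] H))
    (hΦ : ∀ x y, Continuous fun A : H →WOT[ℂ] H => ⟪y, Φ A.toCLM x⟫_ℂ) :
    IsWeaklyClosed (M.comap Φ) := by
  have hc : Continuous fun A : H →WOT[ℂ] H => ContinuousLinearMapWOT.ofCLM (Φ A.toCLM) :=
    ContinuousLinearMapWOT.continuous_iff.2 hΦ
  exact IsClosed.preimage hc hM

/-- If every generator `A ∈ X` satisfies `S A R ∈ M`, then so does every element of `wspan X`. -/
lemma mul_mul_mem_of_mem_wspan [CompleteSpace H] {M : Submodule ℂ (H →L[ℂ] H)}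
    (hM : IsWeaklyClosed M) {X : Set (H →L[ℂ] H)} (S R : H →L[ℂ] H)
    (h : ∀ A ∈ X, S * A * R ∈ M) {A : H →L[ℂ] H} (hA : A ∈ wspan X) : S * A * R ∈ M := by
  have hc : IsWeaklyClosed (M.comap (LinearMap.mulLeftRight ℂ (S, R))) := by
    refine hM.comap _ fun x y => ?_
    have := continuous_inner_apply_wot (R x) (S.adjoint y)
    simpa [ContinuousLinearMap.adjoint_inner_left, LinearMap.mulLeftRight_apply] using this
  have := wspan_le hc (X := X) (fun A hA => by
    simpa [LinearMap.mulLeftRight_apply] using h A hA) hA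
  simpa [LinearMap.mulLeftRight_apply] using this

lemma mul_left_mem_of_mem_wspan [CompleteSpace H] {M : Submodule ℂ (H →L[ℂ] H)}
    (hM : IsWeaklyClosed M) {X : Set (H →L[ℂ] H)} (S : H →L[ℂ] H)
    (h : ∀ A ∈ X, S * A ∈ M) {A : H →L[ℂ] H} (hA : A ∈ wspan X) : S * A ∈ M := by
  simpa using mul_mul_mem_of_mem_wspan hM S 1 (by simpa using h) hA

lemma mul_right_mem_of_mem_wspan [CompleteSpace H] {M : Submodule ℂ (H →L[ℂ] H)}
    (hM : IsWeaklyClosed M) {X : Set (H →L[ℂ] H)} (R : H →L[ℂ] H)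
    (h : ∀ A ∈ X, A * R ∈ M) {A : H →L[ℂ] H} (hA : A ∈ wspan X) : A * R ∈ M := by
  simpa using mul_mul_mem_of_mem_wspan hM 1 R (by simpa using h) hA

lemma commutator_mem_of_mem_wspan [CompleteSpace H] {M : Submodule ℂ (H →L[ℂ] H)}
    (hM : IsWeaklyClosed M) {X : Set (H →L[ℂ] H)} (S : H →L[ℂ] H)
    (h : ∀ A ∈ X, A * S - S * A ∈ M) {A : H →L[ℂ] H} (hA : A ∈ wspan X) :
    A * S - S * A ∈ M := by
  have hc : IsWeaklyClosed (M.comap (LinearMap.mulRight ℂ S - LinearMap.mulLeft ℂ S)) := by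
    refine hM.comap _ fun x y => ?_
    have := (continuous_inner_apply_wot (S x) y).sub
      (continuous_inner_apply_wot x (S.adjoint y))
    refine this.congr fun A => ?_
    simp [ContinuousLinearMap.adjoint_inner_left]
  have := wspan_le hc (X := X) (fun A hA => by simpa using h A hA) hA
  simpa using this

/-- Only finitely many matrix coefficients are involved in a basic weak neighbourhood, so an
operator belongs to a weakly closed space as soon as the finite rank functionals
`B ↦ ∑ ⟪ξ i, B (η i)⟫` that annihilate the space annihilate the operator. -/
lemma IsWeaklyClosed.mem_of_functional [CompleteSpace H] {M : Submodule ℂ (H →L[ℂ] H)}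
    (hM : IsWeaklyClosed M) {A : H →L[ℂ] H}
    (h : ∀ (n : ℕ) (ξ η : Fin n → H), (∀ B ∈ M, ∑ i, ⟪ξ i, B (η i)⟫_ℂ = 0) →
      ∑ i, ⟪ξ i, A (η i)⟫_ℂ = 0) : A ∈ M := by
  by_contra hA
  have ho := hM.isOpen_compl.mem_nhds (x := ContinuousLinearMapWOT.ofCLM A) hA
  rw [ContinuousLinearMapWOT.withSeminorms.mem_nhds_iff] at ho
  obtain ⟨s, r, hr, hs⟩ := ho
  let v : s → H := fun i => (InnerProductSpace.toDual ℂ H).symm i.1.2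
  have hv : ∀ (i : s) (z : H), i.1.2 z = ⟪v i, z⟫_ℂ := fun i z => by simp [v]
  let Φ : (H →L[ℂ] H) →ₗ[ℂ] (s → ℂ) :=
    { toFun := fun B i => ⟪v i, B i.1.1⟫_ℂ
      map_add' := fun B C => by ext i; simp
      map_smul' := fun c B => by ext i; simp }
  have hΦ : Φ A ∉ M.map Φ := by
    rintro ⟨B, hB, hBA⟩
    have : ContinuousLinearMapWOT.ofCLM B ∈
        (s.sup (ContinuousLinearMapWOT.seminormFamily (RingHom.id ℂ) H H)).ball
          (ContinuousLinearMapWOT.ofCLM A) r := by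
      rw [Seminorm.mem_ball]
      refine Seminorm.finset_sup_apply_lt hr fun i hi => ?_
      have h1 : i.2 (B i.1 - A i.1) = 0 := by
        rw [hv ⟨i, hi⟩, inner_sub_right, sub_eq_zero]
        exact congrFun hBA ⟨i, hi⟩
      change ‖i.2 (B i.1 - A i.1)‖ < r
      simpa [h1] using hr
    exact hs this hB
  obtain ⟨g, hgA, hg⟩ := Submodule.exists_le_ker_of_notMem hΦ
  classical
  let e := s.equivFin
  have key : ∀ B : H →L[ℂ] H, g (Φ B) =
      ∑ i : Fin s.card, ⟪star (g (Pi.single (e.symm i) 1)) • v (e.symm i),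
        B (e.symm i).1.1⟫_ℂ := by
    intro B
    rw [e.symm.sum_comp (fun i => ⟪star (g (Pi.single i 1)) • v i, B i.1.1⟫_ℂ)]
    conv_lhs => rw [LinearMap.pi_apply_eq_sum_univ g (Φ B)]
    refine Finset.sum_congr rfl fun i _ => ?_
    simp only [inner_smul_left, RCLike.star_def, RingHomCompTriple.comp_apply, RingHom.id_apply,
      smul_eq_mul, Φ, LinearMap.coe_mk, AddHom.coe_mk]
    rw [mul_comm]
    congr 2
    ext j
    simp [Pi.single_apply, eq_comm]
  refine hgA ?_
  rw [key]
  refine h _ _ _ fun B hB => ?_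
  rw [← key]
  exact hg ⟨B, hB, rfl⟩

lemma IsWeaklyClosed.mem_of_agree [CompleteSpace H] {M : Submodule ℂ (H →L[ℂ] H)}
    (hM : IsWeaklyClosed M) {A : H →L[ℂ] H}
    (h : ∀ (n : ℕ) (η : Fin n → H), ∃ B ∈ M, ∀ i, B (η i) = A (η i)) : A ∈ M := by
  refine hM.mem_of_functional fun n ξ η hf => ?_
  obtain ⟨B, hB, hBA⟩ := h n η
  simpa [hBA] using hf B hB

lemma mul_rankOne (S : H →L[ℂ] H) (y x : H) : S * rankOne ℂ y x = rankOne ℂ (S y) x := by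
  ext z; simp

lemma rankOne_mul [CompleteSpace H] (S : H →L[ℂ] H) (y x : H) :
    rankOne ℂ y x * S = rankOne ℂ y (S.adjoint x) :=
  InnerProductSpace.rankOne_comp y x S

/-- Finite rank operators are weakly dense, so `E B(H) F` is the weakly closed span of its
operators of the form `E (x ⊗ y) F`. -/
lemma IsWeaklyClosed.mul_mul_mem [CompleteSpace H] {M : Submodule ℂ (H →L[ℂ] H)}
    (hM : IsWeaklyClosed M) {E F : H →L[ℂ] H}
    (h : ∀ x y, E * rankOne ℂ y x * F ∈ M) (T : H →L[ℂ] H) : E * T * F ∈ M := by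
  refine hM.mem_of_agree fun n η => ?_
  let W : Submodule ℂ H := Submodule.span ℂ (Set.range fun i => F (η i))
  have : FiniteDimensional ℂ W := FiniteDimensional.span_of_finite ℂ (Set.finite_range _)
  let b := stdOrthonormalBasis ℂ W
  refine ⟨E * (T * W.starProjection) * F, ?_, fun i => ?_⟩
  · rw [b.starProjection_eq_sum_rankOne, Finset.mul_sum, Finset.mul_sum, Finset.sum_mul]
    refine Submodule.sum_mem _ fun i _ => ?_
    rw [mul_rankOne]
    exact h _ _
  · have : W.starProjection (F (η i)) = F (η i) :=
      Submodule.starProjection_eq_self_iff.2 (Submodule.subset_span ⟨i, rfl⟩)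
    simp [this]

lemma IsWeaklyClosed.isClosed {M : Submodule ℂ (H →L[ℂ] H)} (hM : IsWeaklyClosed M) :
    IsClosed (M : Set (H →L[ℂ] H)) :=
  IsClosed.preimage ContinuousLinearMapWOT.continuous_ofCLM hM

/-- The bounded sets of operators are relatively compact in the weak operator topology: a bounded
family has a weak limit along any ultrafilter. -/
lemma exists_wot_limit [CompleteSpace H] {ι : Type*} (U : Ultrafilter ι) (T : ι → H →L[ℂ] H)
    {r : ℝ} (hT : ∀ i, ‖T i‖ ≤ r) :
    ∃ B : H →L[ℂ] H, ∀ x y, Tendsto (fun i => ⟪x, T i y⟫_ℂ) U (𝓝 ⟪x, B y⟫_ℂ) := by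
  have hb : ∀ i x y, ‖⟪x, T i y⟫_ℂ‖ ≤ r * ‖x‖ * ‖y‖ := fun i x y => by
    calc ‖⟪x, T i y⟫_ℂ‖ ≤ ‖x‖ * ‖T i y‖ := norm_inner_le_norm _ _
      _ ≤ ‖x‖ * (r * ‖y‖) := by gcongr; exact (T i).le_of_opNorm_le (hT i) y
      _ = _ := by ring
  have hlim : ∀ x y, ∃ c : ℂ, ‖c‖ ≤ r * ‖x‖ * ‖y‖ ∧
      Tendsto (fun i => ⟪x, T i y⟫_ℂ) U (𝓝 c) := fun x y => by
    have hc := isCompact_closedBall (0 : ℂ) (r * ‖x‖ * ‖y‖)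
    obtain ⟨c, hc, hcU⟩ := hc.ultrafilter_le_nhds (U.map fun i => ⟪x, T i y⟫_ℂ)
      (by
        rw [Filter.le_principal_iff]
        exact Filter.Eventually.of_forall (f := (U : Filter ι)) fun i => by
          simpa using hb i x y)
    exact ⟨c, by simpa using hc, hcU⟩
  choose c hcb hc using hlim
  let B : H →L⋆[ℂ] H →L[ℂ] ℂ := LinearMap.mkContinuous₂
    (LinearMap.mk₂'ₛₗ (starRingEnd ℂ) (RingHom.id ℂ) c
      (fun x x' y => tendsto_nhds_unique (hc _ _)
        (((hc x y).add (hc x' y)).congr fun i => by rw [inner_add_left]))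
      (fun a x y => tendsto_nhds_unique (hc _ _)
        (((hc x y).const_mul (starRingEnd ℂ a)).congr fun i => by rw [inner_smul_left]))
      (fun x y y' => tendsto_nhds_unique (hc _ _)
        (((hc x y).add (hc x y')).congr fun i => by rw [map_add, inner_add_right]))
      (fun a x y => tendsto_nhds_unique (hc _ _)
        (((hc x y).const_mul a).congr fun i => by rw [map_smul, inner_smul_right])))
    r (fun x y => hcb x y)
  refine ⟨(continuousLinearMapOfBilin B).adjoint, fun x y => ?_⟩
  rw [ContinuousLinearMap.adjoint_inner_right, continuousLinearMapOfBilin_apply]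
  exact hc x y

lemma IsWeaklyClosed.mem_of_tendsto [CompleteSpace H] {M : Submodule ℂ (H →L[ℂ] H)}
    (hM : IsWeaklyClosed M) {ι : Type*} {U : Filter ι} [U.NeBot] {T : ι → H →L[ℂ] H}
    {B : H →L[ℂ] H} (hB : ∀ x y, Tendsto (fun i => ⟪x, T i y⟫_ℂ) U (𝓝 ⟪x, B y⟫_ℂ))
    (hT : ∀ᶠ i in U, T i ∈ M) : B ∈ M := by
  have : Tendsto (fun i => ContinuousLinearMapWOT.ofCLM (σ := RingHom.id ℂ) (T i)) U
      (𝓝 (ContinuousLinearMapWOT.ofCLM B)) :=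
    ContinuousLinearMapWOT.tendsto_iff_forall_inner_apply_tendsto.2 fun x y => hB y x
  exact _root_.IsClosed.mem_of_tendsto (s := {A : H →WOT[ℂ] H | A.toCLM ∈ M}) hM this hT

variable [CompleteSpace H]

/-! ### Projections onto closed subspaces -/

section Projections

variable {P Q : ClosedSubmodule ℂ H} {x : H}

lemma proj_apply_mem (P : ClosedSubmodule ℂ H) (x : H) : proj P x ∈ P :=
  Submodule.starProjection_apply_mem P.toSubmodule x

lemma proj_apply_eq_self_iff : proj P x = x ↔ x ∈ P :=
  Submodule.starProjection_eq_self_iff (K := P.toSubmodule)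

lemma proj_apply_of_mem (h : x ∈ P) : proj P x = x := proj_apply_eq_self_iff.2 h

lemma coproj_apply (P : ClosedSubmodule ℂ H) (x : H) : coproj P x = x - proj P x := rfl

lemma coproj_apply_eq_zero_iff : coproj P x = 0 ↔ x ∈ P := by
  rw [coproj_apply, sub_eq_zero, eq_comm, proj_apply_eq_self_iff]

lemma coproj_apply_eq_self_iff : coproj P x = x ↔ proj P x = 0 := by
  rw [coproj_apply, sub_eq_self]

lemma proj_apply_eq_zero_iff : proj P x = 0 ↔ ∀ z ∈ P, ⟪z, x⟫_ℂ = 0 := by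
  rw [proj, Submodule.starProjection_apply_eq_zero_iff, Submodule.mem_orthogonal]
  rfl

@[simp] lemma star_proj (P : ClosedSubmodule ℂ H) : star (proj P) = proj P :=
  (Submodule.starProjection_isSymmetric P.toSubmodule).isSelfAdjoint

@[simp] lemma star_coproj (P : ClosedSubmodule ℂ H) : star (coproj P) = coproj P := by
  simp [coproj]

@[simp] lemma adjoint_proj (P : ClosedSubmodule ℂ H) : (proj P).adjoint = proj P := star_proj P

@[simp] lemma adjoint_coproj (P : ClosedSubmodule ℂ H) : (coproj P).adjoint = coproj P :=
  star_coproj P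

lemma proj_mul_proj_of_le (h : P ≤ Q) : proj P * proj Q = proj P := by
  rw [← star_inj, star_mul, star_proj, star_proj]
  ext x
  exact proj_apply_of_mem (h (proj_apply_mem P x))

lemma proj_mul_proj_of_ge (h : Q ≤ P) : proj P * proj Q = proj Q := by
  ext x
  exact proj_apply_of_mem (h (proj_apply_mem Q x))

@[simp] lemma proj_mul_self (P : ClosedSubmodule ℂ H) : proj P * proj P = proj P :=
  proj_mul_proj_of_le le_rfl

lemma proj_mul_coproj_of_le (h : P ≤ Q) : proj P * coproj Q = 0 := by
  rw [coproj, mul_sub, mul_one, proj_mul_proj_of_le h, sub_self]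

lemma coproj_mul_proj_of_le (h : P ≤ Q) : coproj Q * proj P = 0 := by
  rw [coproj, sub_mul, one_mul, proj_mul_proj_of_ge h, sub_self]

lemma coproj_mul_coproj_of_le (h : P ≤ Q) : coproj P * coproj Q = coproj Q := by
  nth_rw 1 [coproj]
  rw [sub_mul, one_mul, proj_mul_coproj_of_le h, sub_zero]

lemma coproj_mul_coproj_of_ge (h : P ≤ Q) : coproj Q * coproj P = coproj Q := by
  nth_rw 2 [coproj]
  rw [mul_sub, mul_one, coproj_mul_proj_of_le h, sub_zero]

@[simp] lemma proj_mul_coproj (P : ClosedSubmodule ℂ H) : proj P * coproj P = 0 :=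
  proj_mul_coproj_of_le le_rfl

@[simp] lemma coproj_mul_proj (P : ClosedSubmodule ℂ H) : coproj P * proj P = 0 :=
  coproj_mul_proj_of_le le_rfl

@[simp] lemma coproj_mul_self (P : ClosedSubmodule ℂ H) : coproj P * coproj P = coproj P :=
  coproj_mul_coproj_of_le le_rfl

lemma proj_add_coproj (P : ClosedSubmodule ℂ H) : proj P + coproj P = 1 := by
  rw [coproj]; abel

@[simp] lemma proj_mul_self_assoc (P : ClosedSubmodule ℂ H) (A : H →L[ℂ] H) :
    proj P * (proj P * A) = proj P * A := by rw [← mul_assoc, proj_mul_self]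

@[simp] lemma coproj_mul_self_assoc (P : ClosedSubmodule ℂ H) (A : H →L[ℂ] H) :
    coproj P * (coproj P * A) = coproj P * A := by rw [← mul_assoc, coproj_mul_self]

@[simp] lemma proj_mul_coproj_assoc (P : ClosedSubmodule ℂ H) (A : H →L[ℂ] H) :
    proj P * (coproj P * A) = 0 := by rw [← mul_assoc, proj_mul_coproj, zero_mul]

@[simp] lemma coproj_mul_proj_assoc (P : ClosedSubmodule ℂ H) (A : H →L[ℂ] H) :
    coproj P * (proj P * A) = 0 := by rw [← mul_assoc, coproj_mul_proj, zero_mul]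

lemma inner_coproj_self (P : ClosedSubmodule ℂ H) (x : H) :
    ⟪coproj P x, x⟫_ℂ = ⟪coproj P x, coproj P x⟫_ℂ := by
  nth_rw 3 [← adjoint_coproj P]
  rw [ContinuousLinearMap.adjoint_inner_right, ← mul_apply_eq_comp, coproj_mul_self]

lemma inner_proj_self (P : ClosedSubmodule ℂ H) (x : H) :
    ⟪proj P x, x⟫_ℂ = ⟪proj P x, proj P x⟫_ℂ := by
  nth_rw 3 [← adjoint_proj P]
  rw [ContinuousLinearMap.adjoint_inner_right, ← mul_apply_eq_comp, proj_mul_self]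

lemma inner_proj_left (P : ClosedSubmodule ℂ H) (x y : H) :
    ⟪proj P x, y⟫_ℂ = ⟪x, proj P y⟫_ℂ :=
  Submodule.inner_starProjection_left_eq_right P.toSubmodule x y

lemma proj_coproj_apply (P : ClosedSubmodule ℂ H) (x : H) : proj P (coproj P x) = 0 := by
  rw [← mul_apply_eq_comp, proj_mul_coproj, zero_apply]

lemma norm_proj_le (P : ClosedSubmodule ℂ H) : ‖proj P‖ ≤ 1 :=
  Submodule.starProjection_norm_le P.toSubmodule

/-- The orthogonal complement of a set of vectors as a closed subspace. -/
def orth (V : Submodule ℂ H) : ClosedSubmodule ℂ H := ⟨Vᗮ, V.isClosed_orthogonal⟩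

lemma mem_orth {V : Submodule ℂ H} : x ∈ orth V ↔ ∀ z ∈ V, ⟪z, x⟫_ℂ = 0 :=
  Submodule.mem_orthogonal V x

end Projections

/-! ### Nests and nest algebras -/

section Nest

variable {N : CompleteSublattice (ClosedSubmodule ℂ H)}

lemma IsNest.total (hN : IsNest N) (P Q : N) : P ≤ Q ∨ Q ≤ P :=
  (show IsChain (· ≤ ·) (N : Set (ClosedSubmodule ℂ H)) from hN).total P.2 Q.2

lemma IsNest.le_of_not_lt (hN : IsNest N) {P Q : N} (h : ¬ P < Q) : Q ≤ P := by
  rcases hN.total P Q with h' | h'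
  · rcases h'.eq_or_lt with rfl | h''
    · exact le_rfl
    · exact absurd h'' h
  · exact h'

lemma IsNest.lt_of_not_le (hN : IsNest N) {P Q : N} (h : ¬ P ≤ Q) : Q < P :=
  lt_of_le_not_ge ((hN.total P Q).resolve_left h) h

lemma coe_sSup_le {S : Set N} {X : ClosedSubmodule ℂ H} (h : ∀ Q ∈ S, (Q : ClosedSubmodule ℂ H) ≤ X) :
    ((sSup S : N) : ClosedSubmodule ℂ H) ≤ X := by
  rw [CompleteSublattice.coe_sSup]
  refine sSup_le ?_
  rintro _ ⟨Q, hQ, rfl⟩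
  exact h Q hQ

lemma mem_coe_sInf {S : Set N} {x : H} :
    x ∈ ((sInf S : N) : ClosedSubmodule ℂ H) ↔ ∀ Q ∈ S, x ∈ (Q : ClosedSubmodule ℂ H) := by
  rw [CompleteSublattice.coe_sInf]
  simp

lemma pred_le (P : N) : pred N P ≤ P := sSup_le fun _ h => le_of_lt h

lemma le_pred {P Q : N} (h : Q < P) : Q ≤ pred N P := le_sSup h

lemma IsNest.lt_of_lt_pred (hN : IsNest N) {P Q : N} (h : Q < pred N P) :
    ∃ R : N, Q < R ∧ R < P := by
  by_contra! hR
  refine absurd h (not_lt_of_ge (sSup_le fun R hRP => ?_))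
  exact hN.le_of_not_lt fun hQR => hR R hQR hRP

lemma mem_nestAlgebra_iff {T : H →L[ℂ] H} :
    T ∈ nestAlgebra N ↔ ∀ P : N, ∀ x ∈ (P : ClosedSubmodule ℂ H), T x ∈ (P : ClosedSubmodule ℂ H) :=
  ⟨fun h P => h P P.2, fun h P hP => h ⟨P, hP⟩⟩

lemma coproj_mul_mul_proj {T : H →L[ℂ] H} (hT : T ∈ nestAlgebra N) (P : N) :
    coproj (P : ClosedSubmodule ℂ H) * T * proj (P : ClosedSubmodule ℂ H) = 0 := by
  ext x
  exact coproj_apply_eq_zero_iff.2 (hT P P.2 _ (proj_apply_mem _ x))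

lemma mem_nestAlgebra_of_coproj_mul_mul_proj {T : H →L[ℂ] H}
    (h : ∀ P : N, coproj (P : ClosedSubmodule ℂ H) * T * proj (P : ClosedSubmodule ℂ H) = 0) :
    T ∈ nestAlgebra N := by
  rw [mem_nestAlgebra_iff]
  intro P x hx
  rw [← coproj_apply_eq_zero_iff]
  have := DFunLike.congr_fun (h P) x
  simpa [proj_apply_of_mem hx] using this

lemma mul_proj_of_mem_nestAlgebra {T : H →L[ℂ] H} (hT : T ∈ nestAlgebra N) (P : N) :
    T * proj (P : ClosedSubmodule ℂ H) =
      proj (P : ClosedSubmodule ℂ H) * (T * proj (P : ClosedSubmodule ℂ H)) := by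
  have := coproj_mul_mul_proj hT P
  rw [coproj, sub_mul, sub_mul, one_mul, sub_eq_zero, mul_assoc] at this
  exact this

lemma mul_proj_mul_of_mem_nestAlgebra {T : H →L[ℂ] H} (hT : T ∈ nestAlgebra N) (P : N)
    (A : H →L[ℂ] H) : T * (proj (P : ClosedSubmodule ℂ H) * A) =
      proj (P : ClosedSubmodule ℂ H) * (T * (proj (P : ClosedSubmodule ℂ H) * A)) := by
  have := congrArg (· * A) (mul_proj_of_mem_nestAlgebra hT P)
  simpa only [mul_assoc] using this

lemma coproj_mul_of_mem_nestAlgebra {T : H →L[ℂ] H} (hT : T ∈ nestAlgebra N) (P : N) :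
    coproj (P : ClosedSubmodule ℂ H) * T =
      coproj (P : ClosedSubmodule ℂ H) * (T * coproj (P : ClosedSubmodule ℂ H)) := by
  have := coproj_mul_mul_proj hT P
  nth_rw 3 [coproj]
  rw [← mul_assoc, mul_sub, mul_one, this, sub_zero]

lemma IsNest.proj_mem (hN : IsNest N) (P : N) :
    proj (P : ClosedSubmodule ℂ H) ∈ nestAlgebra N := by
  rw [mem_nestAlgebra_iff]
  intro Q x hx
  rcases hN.total P Q with h | h
  · exact h (proj_apply_mem _ x)
  · rwa [proj_apply_of_mem (h hx)]

lemma IsNest.coproj_mem (hN : IsNest N) (P : N) :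
    coproj (P : ClosedSubmodule ℂ H) ∈ nestAlgebra N :=
  sub_mem (one_mem _) (hN.proj_mem P)

lemma IsNest.proj_mul_mul_coproj_mem (hN : IsNest N) (P : N) (T : H →L[ℂ] H) :
    proj (P : ClosedSubmodule ℂ H) * T * coproj (P : ClosedSubmodule ℂ H) ∈ nestAlgebra N := by
  rw [mem_nestAlgebra_iff]
  intro Q x hx
  rcases hN.total P Q with h | h
  · exact h (proj_apply_mem _ _)
  · have : coproj (P : ClosedSubmodule ℂ H) x = 0 := coproj_apply_eq_zero_iff.2 (h hx)
    simp [this]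

lemma IsNest.commute_proj (hN : IsNest N) (P Q : N) :
    Commute (proj (P : ClosedSubmodule ℂ H)) (proj (Q : ClosedSubmodule ℂ H)) := by
  rcases hN.total P Q with h | h
  · exact (proj_mul_proj_of_le h).trans (proj_mul_proj_of_ge h).symm
  · exact (proj_mul_proj_of_ge h).trans (proj_mul_proj_of_le h).symm

/-- The rank one operator `x ⊗ y` belongs to the nest algebra as soon as `y ∈ P` and `x` is
orthogonal to the immediate predecessor of `P`, for some `P` in the nest. -/
lemma IsNest.rankOne_mem (hN : IsNest N) {P : N} {x y : H} (hy : y ∈ (P : ClosedSubmodule ℂ H))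
    (hx : proj (pred N P : ClosedSubmodule ℂ H) x = 0) : rankOne ℂ y x ∈ nestAlgebra N := by
  rw [mem_nestAlgebra_iff]
  intro Q z hz
  rw [rankOne_apply]
  by_cases h : P ≤ Q
  · exact (Q : ClosedSubmodule ℂ H).toSubmodule.smul_mem _ (h hy)
  · have hz' : z ∈ (pred N P : ClosedSubmodule ℂ H) := le_pred (hN.lt_of_not_le h) hz
    have : ⟪x, z⟫_ℂ = 0 := by
      rw [← inner_conj_symm, proj_apply_eq_zero_iff.1 hx z hz', map_zero]
    rw [this, zero_smul]
    exact zero_mem _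

lemma mem_lowerProj (z : H) : z ∈ (lowerProj N z : ClosedSubmodule ℂ H) :=
  mem_coe_sInf.2 fun _ hQ => proj_apply_eq_self_iff.1 hQ

lemma lowerProj_le {z : H} {Q : N} (h : z ∈ (Q : ClosedSubmodule ℂ H)) : lowerProj N z ≤ Q :=
  sInf_le (proj_apply_of_mem h)

lemma coe_upperProj_le_orth (z : H) :
    (upperProj N z : ClosedSubmodule ℂ H) ≤ orth (Submodule.span ℂ {z}) := by
  refine coe_sSup_le fun Q hQ x hx => mem_orth.2 fun w hw => ?_
  obtain ⟨c, rfl⟩ := Submodule.mem_span_singleton.1 hw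
  rw [inner_smul_left, ← inner_conj_symm, proj_apply_eq_zero_iff.1 hQ x hx, map_zero, mul_zero]

lemma proj_upperProj (z : H) : proj (upperProj N z : ClosedSubmodule ℂ H) z = 0 := by
  rw [proj_apply_eq_zero_iff]
  intro w hw
  have := mem_orth.1 (coe_upperProj_le_orth z hw) z (Submodule.mem_span_singleton_self z)
  rw [← inner_conj_symm, this, map_zero]

lemma le_upperProj {z : H} {Q : N} (h : proj (Q : ClosedSubmodule ℂ H) z = 0) :
    Q ≤ upperProj N z := le_sSup h

/-- Nests are reflexive: a closed subspace invariant under the nest algebra belongs to the nest. -/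
lemma IsNest.mem_of_invariant (hN : IsNest N) (V : ClosedSubmodule ℂ H)
    (hV : ∀ T ∈ nestAlgebra N, ∀ v ∈ V, T v ∈ V) : V ∈ N := by
  have key : ∀ (Q : N) (v : H), v ∈ V → v ∉ (pred N Q : ClosedSubmodule ℂ H) →
      (Q : ClosedSubmodule ℂ H) ≤ V := by
    intro Q v hv hvQ y hy
    have h1 := hV _ (hN.rankOne_mem (P := Q) (x := coproj (pred N Q : ClosedSubmodule ℂ H) v) hy
      (proj_coproj_apply _ _)) v hv
    rw [rankOne_apply, inner_coproj_self] at h1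
    have h2 : ⟪coproj (pred N Q : ClosedSubmodule ℂ H) v,
        coproj (pred N Q : ClosedSubmodule ℂ H) v⟫_ℂ ≠ 0 := by
      rw [inner_self_ne_zero]
      exact fun h => hvQ (coproj_apply_eq_zero_iff.1 h)
    exact (V.toSubmodule.smul_mem_iff h2).1 h1
  have hle : ∀ v ∈ V, (lowerProj N v : ClosedSubmodule ℂ H) ≤ V := by
    intro v hv
    by_cases h : v ∈ (pred N (lowerProj N v) : ClosedSubmodule ℂ H)
    · refine le_trans (b := (pred N (lowerProj N v) : ClosedSubmodule ℂ H)) (lowerProj_le h) ?_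
      refine coe_sSup_le fun Q hQ => key Q v hv fun hvQ => ?_
      exact absurd (lowerProj_le (pred_le Q hvQ)) (not_le_of_gt hQ)
    · exact key _ v hv h
  have : ((sSup {Q : N | (Q : ClosedSubmodule ℂ H) ≤ V} : N) : ClosedSubmodule ℂ H) = V := by
    refine le_antisymm (coe_sSup_le fun Q hQ => hQ) fun v hv => ?_
    exact (le_sSup (a := lowerProj N v) (hle v hv) : lowerProj N v ≤ _) (mem_lowerProj v)
  rw [← this]
  exact (sSup {Q : N | (Q : ClosedSubmodule ℂ H) ≤ V}).2

/-- A closed subspace invariant under the adjoints of the nest algebra is the orthogonal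
complement of an element of the nest. -/
lemma IsNest.exists_of_adjoint_invariant (hN : IsNest N) (V : ClosedSubmodule ℂ H)
    (hV : ∀ T ∈ nestAlgebra N, ∀ v ∈ V, T.adjoint v ∈ V) :
    ∃ W : N, ∀ x, x ∈ V ↔ proj (W : ClosedSubmodule ℂ H) x = 0 := by
  have h : orth V.toSubmodule ∈ N := by
    refine hN.mem_of_invariant _ fun T hT v hv => ?_
    rw [mem_orth] at hv ⊢
    intro z hz
    rw [← ContinuousLinearMap.adjoint_inner_left]
    exact hv _ (hV T hT z hz)
  refine ⟨⟨_, h⟩, fun x => ?_⟩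
  rw [proj_apply_eq_zero_iff]
  refine Iff.trans ?_ (Submodule.mem_orthogonal V.toSubmoduleᗮ x)
  rw [Submodule.orthogonal_orthogonal]
  rfl

/-! ### Density of the rank one operators -/

variable (N) in
/-- The rank one operators `x ⊗ y` with `y ∈ P` and `x ⊥ P_-` for some `P` in the nest; all of
them belong to the nest algebra. -/
def nestRankOnes : Set (H →L[ℂ] H) :=
  {R | ∃ (P : N) (x y : H), y ∈ (P : ClosedSubmodule ℂ H) ∧
    proj (pred N P : ClosedSubmodule ℂ H) x = 0 ∧ R = rankOne ℂ y x}

/-- A finite rank operator that maps each `P` in the nest into `P_-` cannot map a nonzero subspace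
onto itself. If `S` is such a subspace and `P` is the least element of the nest containing it, then
`P = P_-`; but the finite dimensional spaces `F Q`, `Q < P`, are eventually constant, so `F P` and
hence `S` is contained in some `Q < P`. -/
lemma IsNest.eq_bot_of_map_eq (hN : IsNest N) {F : H →L[ℂ] H} {W : Submodule ℂ H}
    [FiniteDimensional ℂ W] (hFW : ∀ x, F x ∈ W)
    (hF : ∀ (P : N), ∀ y ∈ (P : ClosedSubmodule ℂ H), F y ∈ (pred N P : ClosedSubmodule ℂ H))
    {S : Submodule ℂ H} (hS : ∀ s ∈ S, ∃ t ∈ S, F t = s) : S = ⊥ := by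
  set P : N := sInf {Q : N | S ≤ (Q : ClosedSubmodule ℂ H).toSubmodule} with hP
  have hSP : ∀ s ∈ S, s ∈ (P : ClosedSubmodule ℂ H) := fun s hs =>
    mem_coe_sInf.2 fun Q hQ => hQ hs
  have hPle : ∀ Q : N, (∀ s ∈ S, s ∈ (Q : ClosedSubmodule ℂ H)) → P ≤ Q := fun Q hQ => sInf_le hQ
  have hpred : P ≤ pred N P := hPle _ fun s hs => by
    obtain ⟨t, ht, rfl⟩ := hS s hs
    exact hF P t (hSP t ht)
  by_contra hne
  have hPbot : ⊥ < P := by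
    rw [bot_lt_iff_ne_bot]
    intro h
    refine hne ((Submodule.eq_bot_iff _).2 fun s hs => ?_)
    have := hSP s hs
    rwa [h] at this
  let F' : H →ₗ[ℂ] W := F.toLinearMap.codRestrict W hFW
  obtain ⟨m, ⟨Q₀, hQ₀, rfl⟩, hmax⟩ := (wellFounded_gt (α := Submodule ℂ W)).has_min
    ((fun Q : N => (Q : ClosedSubmodule ℂ H).toSubmodule.map F') '' {Q : N | Q < P})
    ⟨_, ⊥, hPbot, rfl⟩
  have hQ : ∀ Q : N, Q < P → (Q : ClosedSubmodule ℂ H) ≤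
      (Q₀ : ClosedSubmodule ℂ H).comap F := by
    intro Q hQP x hx
    rw [ClosedSubmodule.mem_comap]
    have hle : (Q : ClosedSubmodule ℂ H).toSubmodule.map F' ≤
        (Q₀ : ClosedSubmodule ℂ H).toSubmodule.map F' := by
      rcases hN.total Q Q₀ with h | h
      · exact Submodule.map_mono h
      · have h1 : (Q₀ : ClosedSubmodule ℂ H).toSubmodule.map F' ≤
            (Q : ClosedSubmodule ℂ H).toSubmodule.map F' := Submodule.map_mono h
        by_contra h2
        exact hmax _ ⟨Q, hQP, rfl⟩ (lt_of_le_not_ge h1 h2)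
    obtain ⟨z, hz, hzx⟩ := hle ⟨x, hx, rfl⟩
    have : F x = F z := (congrArg Subtype.val hzx).symm
    rw [this]
    exact pred_le Q₀ (hF Q₀ z hz)
  have hPQ : (P : ClosedSubmodule ℂ H) ≤ (Q₀ : ClosedSubmodule ℂ H).comap F :=
    le_trans (b := (pred N P : ClosedSubmodule ℂ H)) hpred (coe_sSup_le fun Q h => hQ Q h)
  refine absurd (hPle Q₀ fun s hs => ?_) (not_le_of_gt hQ₀)
  obtain ⟨t, ht, rfl⟩ := hS s hs
  exact hPQ (hSP t ht)

/-- **Erdos density theorem**: the identity is a weak limit of finite sums of rank one operators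
of the nest algebra. A functional annihilating these rank one operators is `A ↦ tr (F A)` with `F` of
finite rank mapping each `P` into `P_-`; such an `F` is nilpotent, so `tr F = 0`. -/
theorem IsNest.one_mem_wspan_nestRankOnes (hN : IsNest N) :
    (1 : H →L[ℂ] H) ∈ wspan (nestRankOnes N) := by
  refine (isWeaklyClosed_wspan _).mem_of_functional fun n ξ η hf => ?_
  let F : H →L[ℂ] H := ∑ i, rankOne ℂ (η i) (ξ i)
  have hFz : ∀ z, F z = ∑ i, ⟪ξ i, z⟫_ℂ • η i := fun z => by simp [F]
  let W : Submodule ℂ H := Submodule.span ℂ (Set.range η)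
  have : FiniteDimensional ℂ W := FiniteDimensional.span_of_finite ℂ (Set.finite_range _)
  have hηW : ∀ i, η i ∈ W := fun i => Submodule.subset_span ⟨i, rfl⟩
  have hFW : ∀ z, F z ∈ W := fun z => by
    rw [hFz]
    exact Submodule.sum_mem _ fun i _ => Submodule.smul_mem _ _ (hηW i)
  have hF : ∀ (P : N), ∀ y ∈ (P : ClosedSubmodule ℂ H),
      F y ∈ (pred N P : ClosedSubmodule ℂ H) := by
    intro P y hy
    rw [← coproj_apply_eq_zero_iff, ← inner_self_eq_zero (𝕜 := ℂ), ← inner_coproj_self]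
    set x := coproj (pred N P : ClosedSubmodule ℂ H) (F y)
    have := hf _ (subset_wspan _ ⟨P, x, y, hy, proj_coproj_apply _ _, rfl⟩)
    rw [hFz, inner_sum, ← this]
    refine Finset.sum_congr rfl fun i _ => ?_
    rw [rankOne_apply, inner_smul_right, inner_smul_right, mul_comm]
  let f : W →ₗ[ℂ] W := (F.toLinearMap.codRestrict W hFW) ∘ₗ W.subtype
  have hfv : ∀ w : W, (f w : H) = F w := fun w => rfl
  have htr : LinearMap.trace ℂ W f = ∑ i, ⟪ξ i, η i⟫_ℂ := by
    have : f = ∑ i, ((innerSL ℂ (ξ i)).toLinearMap ∘ₗ W.subtype).smulRight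
        (⟨η i, hηW i⟩ : W) := by
      ext w
      simp [hfv, hFz]
    rw [this, map_sum]
    refine Finset.sum_congr rfl fun i _ => ?_
    rw [LinearMap.trace_smulRight]
    simp
  have hnil : IsNilpotent f := by
    obtain ⟨k, hk⟩ := Filter.eventually_atTop.mp f.eventually_iInf_range_pow_eq
    refine ⟨k, ?_⟩
    have hS : (LinearMap.range (f ^ k)).map W.subtype = ⊥ := by
      refine hN.eq_bot_of_map_eq hFW hF ?_
      rintro _ ⟨s, hs, rfl⟩
      have hs' : s ∈ LinearMap.range (f ^ (k + 1)) := by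
        rw [← hk (k + 1) (by omega), hk k le_rfl]
        exact hs
      obtain ⟨w, rfl⟩ := hs'
      refine ⟨_, ⟨(f ^ k) w, ⟨w, rfl⟩, rfl⟩, ?_⟩
      rw [pow_succ', Module.End.mul_apply]
      rfl
    rwa [(Submodule.map_injective_of_injective W.injective_subtype).eq_iff' (Submodule.map_bot _),
      LinearMap.range_eq_bot] at hS
  have := LinearMap.isNilpotent_trace_of_isNilpotent hnil
  rw [isNilpotent_iff_eq_zero, htr] at this
  simpa using this

lemma IsNest.mem_of_rankOne_right (hN : IsNest N) {M : Submodule ℂ (H →L[ℂ] H)}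
    (hM : IsWeaklyClosed M) {A : H →L[ℂ] H}
    (h : ∀ (P : N) (x y : H), y ∈ (P : ClosedSubmodule ℂ H) →
      proj (pred N P : ClosedSubmodule ℂ H) x = 0 → rankOne ℂ (A y) x ∈ M) : A ∈ M := by
  have := mul_left_mem_of_mem_wspan hM A (fun R hR => ?_) hN.one_mem_wspan_nestRankOnes
  · simpa using this
  · obtain ⟨P, x, y, hy, hx, rfl⟩ := hR
    rw [mul_rankOne]
    exact h P x y hy hx

lemma IsNest.mem_of_rankOne_left (hN : IsNest N) {M : Submodule ℂ (H →L[ℂ] H)}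
    (hM : IsWeaklyClosed M) {A : H →L[ℂ] H}
    (h : ∀ (P : N) (x y : H), y ∈ (P : ClosedSubmodule ℂ H) →
      proj (pred N P : ClosedSubmodule ℂ H) x = 0 → rankOne ℂ y (A.adjoint x) ∈ M) : A ∈ M := by
  have := mul_right_mem_of_mem_wspan hM A (fun R hR => ?_) hN.one_mem_wspan_nestRankOnes
  · simpa using this
  · obtain ⟨P, x, y, hy, hx, rfl⟩ := hR
    rw [rankOne_mul]
    exact h P x y hy hx

end Nest

/-! ### Lie modules over nest algebras -/

section Lie

variable {N : CompleteSublattice (ClosedSubmodule ℂ H)} {L : Submodule ℂ (H →L[ℂ] H)}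
  {P : ClosedSubmodule ℂ H}

lemma mul_mul_eq_zero_of_mul_eq_zero {R : Type*} [Ring R] {a b : R} (h : a * b = 0) (c : R) :
    a * (b * c) = 0 := by rw [← mul_assoc, h, zero_mul]

lemma IsLieModule.commutator_sub_mem (hL : IsLieModule N L) {T S : H →L[ℂ] H} (hT : T ∈ L)
    (hS : S ∈ nestAlgebra N) : S * T - T * S ∈ L := by
  rw [← neg_sub]
  exact L.neg_mem (hL T hT S hS)

/-- The corner `P T P^⊥` is a combination of `[T, P]` and `[[T, P], P]`. -/
lemma IsLieModule.proj_mul_mul_coproj_mem (hL : IsLieModule N L) (hN : IsNest N) (hP : P ∈ N)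
    {T : H →L[ℂ] H} (hT : T ∈ L) : proj P * T * coproj P ∈ L := by
  have hp := hN.proj_mem ⟨P, hP⟩
  have h1 := hL T hT _ hp
  have h2 := L.smul_mem (1 / 2 : ℂ) (L.sub_mem (hL _ h1 _ hp) h1)
  convert h2 using 1
  simp only [coproj, mul_sub, sub_mul, mul_assoc, proj_mul_self, proj_mul_self_assoc, mul_one]
  module

lemma IsLieModule.coproj_mul_mul_proj_mem (hL : IsLieModule N L) (hN : IsNest N) (hP : P ∈ N)
    {T : H →L[ℂ] H} (hT : T ∈ L) : coproj P * T * proj P ∈ L := by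
  have hp := hN.proj_mem ⟨P, hP⟩
  have h1 := hL T hT _ hp
  have h2 := L.smul_mem (1 / 2 : ℂ) (L.add_mem (hL _ h1 _ hp) h1)
  convert h2 using 1
  simp only [coproj, mul_sub, sub_mul, mul_assoc, proj_mul_self, proj_mul_self_assoc, one_mul]
  module

/-- If some `T ∈ L` does not leave `P` invariant, then `P B(H) P^⊥ ⊆ L`: with `t = P^⊥ T P` and
`s = x ⊗ y`, `y ∈ P`, `x ∈ P^⊥`, one has `[[t, s], s] = -2 s t s = -2 ⟪x, t y⟫ s`. -/
lemma IsLieModule.corner_mem (hL : IsLieModule N L) (hLc : IsWeaklyClosed L) (hN : IsNest N)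
    (hP : P ∈ N) {T : H →L[ℂ] H} (hT : T ∈ L) (hTP : coproj P * T * proj P ≠ 0)
    (A : H →L[ℂ] H) : proj P * A * coproj P ∈ L := by
  set t := coproj P * T * proj P with ht
  have htL : t ∈ L := hL.coproj_mul_mul_proj_mem hN hP hT
  let s : H → H → (H →L[ℂ] H) := fun x y => proj P * rankOne ℂ y x * coproj P
  let b : H → H → ℂ := fun x y => ⟪coproj P x, t (proj P y)⟫_ℂ
  have hs : ∀ x y z, s x y z = ⟪coproj P x, z⟫_ℂ • proj P y := fun x y z => by
    simp only [s, mul_apply_eq_comp, rankOne_apply, map_smul]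
    rw [← ContinuousLinearMap.adjoint_inner_left, adjoint_coproj]
  have hmem : ∀ x y, b x y ≠ 0 → s x y ∈ L := by
    intro x y hxy
    have hsN : s x y ∈ nestAlgebra N := hN.proj_mul_mul_coproj_mem ⟨P, hP⟩ _
    have h1 := hL _ (hL t htL _ hsN) _ hsN
    have hss : s x y * s x y = 0 := by
      simp only [s, mul_assoc, coproj_mul_proj_assoc, mul_zero]
    have hsts : s x y * t * s x y = b x y • s x y := by
      ext z
      simp only [mul_apply_eq_comp, hs, map_smul, smul_apply, b]
      rw [smul_comm]
    have h2 : (t * s x y - s x y * t) * s x y - s x y * (t * s x y - s x y * t) =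
        (-2 * b x y) • s x y := by
      rw [sub_mul, mul_sub, mul_assoc t, hss, ← mul_assoc (s x y) (s x y), hss,
        ← mul_assoc (s x y) t, hsts]
      simp only [mul_zero, zero_mul]
      module
    rw [h2] at h1
    exact (L.smul_mem_iff (by simpa using hxy)).1 h1
  have hadd1 : ∀ x x' y, s (x + x') y = s x y + s x' y := fun x x' y => by
    simp only [s, map_add, mul_add, add_mul]
  have hadd2 : ∀ x y y', s x (y + y') = s x y + s x y' := fun x y y' => by
    simp only [s, map_add, add_apply, mul_add, add_mul]
  have hb1 : ∀ x x' y, b (x + x') y = b x y + b x' y := fun x x' y => by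
    simp only [b, map_add, inner_add_left]
  have hb2 : ∀ x y y', b x (y + y') = b x y + b x y' := fun x y y' => by
    simp only [b, map_add, inner_add_right]
  obtain ⟨x₀, y₀, h₀⟩ : ∃ x y, b x y ≠ 0 := by
    by_contra! h
    refine hTP (ContinuousLinearMap.ext fun y => ?_)
    have h1 := h (t y) y
    have h2 : ∀ y, t (proj P y) = t y := fun y => by
      rw [← mul_apply_eq_comp, ht, mul_assoc, proj_mul_self]
    have h3 : coproj P (t y) = t y := by
      rw [← mul_apply_eq_comp, ht, ← mul_assoc, ← mul_assoc, coproj_mul_self]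
    simp only [b, h2, h3] at h1
    simpa using h1
  have hall1 : ∀ x y, (∃ x', b x' y ≠ 0) → s x y ∈ L := by
    rintro x y ⟨x', hx'⟩
    by_cases h : b x y = 0
    · have h1 := hmem (x + x') y (by rw [hb1, h, zero_add]; exact hx')
      rw [hadd1] at h1
      exact (L.add_mem_iff_left (hmem x' y hx')).1 h1
    · exact hmem x y h
  suffices h : ∀ x y, proj P * rankOne ℂ y x * coproj P ∈ L from hLc.mul_mul_mem h A
  intro x y
  change s x y ∈ L
  by_cases h : ∃ x', b x' y ≠ 0
  · exact hall1 x y h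
  · push Not at h
    have h1 := hall1 x (y + y₀) ⟨x₀, by rw [hb2, h, zero_add]; exact h₀⟩
    rw [hadd2] at h1
    exact (L.add_mem_iff_left (hall1 x y₀ ⟨x₀, h₀⟩)).1 h1

variable (N L) in
/-- The operators whose weakly closed spans make up `bimodK N L`. -/
def kernelGenerators : Set (H →L[ℂ] H) :=
  {A | ∃ P ∈ N, ∃ T ∈ L, A = proj P * T * coproj P} ∪
  {A | ∃ P ∈ N, ∃ T ∈ L, A = coproj P * T * proj P} ∪
  {A | ∃ P ∈ N, ∃ T ∈ L, ∃ S ∈ nestAlgebra N, A = proj P * S * coproj P * T * proj P} ∪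
  {A | ∃ P ∈ N, ∃ T ∈ L, ∃ S ∈ nestAlgebra N, A = coproj P * T * proj P * S * coproj P}

variable (N L) in
/-- The weak closure of `bimodK N L`. The two spaces turn out to be equal. -/
def bimodKClosure : Submodule ℂ (H →L[ℂ] H) := wspan (kernelGenerators N L)

lemma bimodKV_le : bimodKV N L ≤ bimodK N L := le_sup_of_le_left (le_sup_of_le_left le_sup_left)
lemma bimodKL_le : bimodKL N L ≤ bimodK N L := le_sup_of_le_left (le_sup_of_le_left le_sup_right)
lemma bimodKD_le : bimodKD N L ≤ bimodK N L := le_sup_of_le_left le_sup_right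
lemma bimodKDelta_le : bimodKDelta N L ≤ bimodK N L := le_sup_right

lemma bimodK_le_bimodKClosure : bimodK N L ≤ bimodKClosure N L := by
  refine sup_le (sup_le (sup_le ?_ ?_) ?_) ?_ <;> refine wspan_mono fun A hA => ?_
  · exact Or.inl (Or.inl (Or.inl hA))
  · exact Or.inl (Or.inl (Or.inr hA))
  · exact Or.inl (Or.inr hA)
  · exact Or.inr hA

lemma mem_bimodKV (hP : P ∈ N) {T : H →L[ℂ] H} (hT : T ∈ L) :
    proj P * T * coproj P ∈ bimodKV N L := subset_wspan _ ⟨P, hP, T, hT, rfl⟩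

lemma mem_bimodKL (hP : P ∈ N) {T : H →L[ℂ] H} (hT : T ∈ L) :
    coproj P * T * proj P ∈ bimodKL N L := subset_wspan _ ⟨P, hP, T, hT, rfl⟩

lemma mem_bimodKD (hP : P ∈ N) {T S : H →L[ℂ] H} (hT : T ∈ L) (hS : S ∈ nestAlgebra N) :
    proj P * S * coproj P * T * proj P ∈ bimodKD N L := subset_wspan _ ⟨P, hP, T, hT, S, hS, rfl⟩

lemma mem_bimodKDelta (hP : P ∈ N) {T S : H →L[ℂ] H} (hT : T ∈ L) (hS : S ∈ nestAlgebra N) :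
    coproj P * T * proj P * S * coproj P ∈ bimodKDelta N L :=
  subset_wspan _ ⟨P, hP, T, hT, S, hS, rfl⟩

/-- The commutator of `t = P^⊥ T P` and `s = P S P^⊥`. -/
lemma IsLieModule.corner_commutator_mem (hL : IsLieModule N L) (hN : IsNest N) (hP : P ∈ N)
    {T : H →L[ℂ] H} (hT : T ∈ L) (S : H →L[ℂ] H) :
    coproj P * T * proj P * S * coproj P - proj P * S * coproj P * T * proj P ∈ L := by
  convert hL _ (hL.coproj_mul_mul_proj_mem hN hP hT) _ (hN.proj_mul_mul_coproj_mem ⟨P, hP⟩ S)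
    using 2 <;> simp only [mul_assoc, proj_mul_self_assoc, coproj_mul_self_assoc]

lemma IsLieModule.corner_mul_mem (hL : IsLieModule N L) (hLc : IsWeaklyClosed L) (hN : IsNest N)
    (hP : P ∈ N) {T : H →L[ℂ] H} (hT : T ∈ L) {A C : H →L[ℂ] H}
    (h : coproj P * T * proj P = 0 → A = 0) (hA : A = proj P * C * coproj P) : A ∈ L := by
  by_cases h0 : coproj P * T * proj P = 0
  · rw [h h0]; exact L.zero_mem
  · rw [hA]; exact hL.corner_mem hLc hN hP hT h0 C

theorem IsLieModule.commutator_bimodK_mem (hL : IsLieModule N L) (hLc : IsWeaklyClosed L)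
    (hN : IsNest N) {K R : H →L[ℂ] H} (hK : K ∈ bimodK N L) (hR : R ∈ nestAlgebra N) :
    K * R - R * K ∈ L := by
  suffices h : bimodK N L ≤ L.comap (LinearMap.mulRight ℂ R - LinearMap.mulLeft ℂ R) by
    simpa using h hK
  refine sup_le (sup_le (sup_le ?_ ?_) ?_) ?_ <;> intro A hA <;>
    simp only [Submodule.mem_comap, LinearMap.sub_apply, LinearMap.mulRight_apply,
      LinearMap.mulLeft_apply] <;>
    refine commutator_mem_of_mem_wspan hLc R ?_ hA
  · rintro _ ⟨P, hP, T, hT, rfl⟩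
    exact hL _ (hL.proj_mul_mul_coproj_mem hN hP hT) R hR
  · rintro _ ⟨P, hP, T, hT, rfl⟩
    exact hL _ (hL.coproj_mul_mul_proj_mem hN hP hT) R hR
  · rintro _ ⟨P, hP, T, hT, S, hS, rfl⟩
    have hp := hN.proj_mem ⟨P, hP⟩
    have h0 := hL _ (hL.corner_commutator_mem hN hP hT S) _ (mul_mem (mul_mem hp hR) hp)
    have h1 : proj P * (S * coproj P * T * proj P * R) * coproj P ∈ L :=
      hL.corner_mul_mem hLc hN hP hT (fun h => by
        have : S * coproj P * T * proj P = S * (coproj P * T * proj P) := by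
          simp only [mul_assoc]
        rw [this, h]; simp) rfl
    have hRp : ∀ A, R * (proj P * A) = proj P * (R * (proj P * A)) :=
      mul_proj_mul_of_mem_nestAlgebra hR ⟨P, hP⟩
    have hpR : proj P * R = proj P * (R * proj P) + proj P * (R * coproj P) := by
      rw [← mul_add, ← mul_add, proj_add_coproj, mul_one]
    convert L.sub_mem h1 h0 using 1
    simp only [mul_assoc, sub_mul, mul_sub, coproj_mul_proj_assoc,
      proj_mul_coproj_assoc, mul_zero, proj_mul_self_assoc]
    rw [hRp, hpR]
    simp only [mul_add, proj_mul_self_assoc]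
    abel
  · rintro _ ⟨P, hP, T, hT, S, hS, rfl⟩
    have hq := hN.coproj_mem ⟨P, hP⟩
    have h0 := hL _ (hL.corner_commutator_mem hN hP hT S) _ (mul_mem (mul_mem hq hR) hq)
    have h1 : proj P * (R * coproj P * T * proj P * S) * coproj P ∈ L :=
      hL.corner_mul_mem hLc hN hP hT (fun h => by
        have : R * coproj P * T * proj P = R * (coproj P * T * proj P) := by
          simp only [mul_assoc]
        rw [this, h]; simp) rfl
    have hqR : coproj P * R = coproj P * (R * coproj P) :=
      coproj_mul_of_mem_nestAlgebra hR ⟨P, hP⟩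
    convert L.sub_mem h0 h1 using 1
    simp only [mul_assoc, sub_mul, mul_sub, coproj_mul_proj_assoc,
      proj_mul_coproj_assoc, mul_zero, coproj_mul_self_assoc]
    have : R * (coproj P * (T * (proj P * (S * coproj P)))) =
        proj P * (R * (coproj P * (T * (proj P * (S * coproj P))))) +
        coproj P * (R * (coproj P * (T * (proj P * (S * coproj P))))) := by
      rw [← add_mul, proj_add_coproj, one_mul]
    rw [hqR, this]
    simp only [mul_add, proj_mul_self_assoc, coproj_mul_self_assoc, proj_mul_coproj_assoc,
      coproj_mul_proj_assoc]
    abel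

/-- The generators of `K(L)` are multiplied into `K(L)` by the nest algebra. -/
lemma IsLieModule.mul_mem_bimodK (hL : IsLieModule N L) (hLc : IsWeaklyClosed L) (hN : IsNest N)
    {K R : H →L[ℂ] H} (hK : K ∈ kernelGenerators N L) (hR : R ∈ nestAlgebra N) :
    K * R ∈ bimodK N L := by
  rcases hK with ((⟨P, hP, T, hT, rfl⟩ | ⟨P, hP, T, hT, rfl⟩) | ⟨P, hP, T, hT, S, hS, rfl⟩) |
    ⟨P, hP, T, hT, S, hS, rfl⟩
  all_goals
    have hp := hN.proj_mem ⟨P, hP⟩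
    have hq := hN.coproj_mem ⟨P, hP⟩
    have hqR : coproj P * R = coproj P * (R * coproj P) :=
      coproj_mul_of_mem_nestAlgebra hR ⟨P, hP⟩
    have hpR : proj P * R = proj P * (R * proj P) + proj P * (R * coproj P) := by
      rw [← mul_add, ← mul_add, proj_add_coproj, mul_one]
  · have h := hL _ (hL.proj_mul_mul_coproj_mem hN hP hT) _ (mul_mem (mul_mem hq hR) hq)
    convert bimodKV_le (mem_bimodKV hP h) using 1
    simp only [mul_assoc, coproj_mul_proj_assoc,
      mul_zero, coproj_mul_self_assoc, coproj_mul_self, proj_mul_self_assoc, sub_zero]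
    rw [hqR]
  · have h := hL _ (hL.coproj_mul_mul_proj_mem hN hP hT) _ (mul_mem (mul_mem hp hR) hp)
    convert add_mem (bimodKL_le (mem_bimodKL hP h)) (bimodKDelta_le (mem_bimodKDelta hP hT hR))
      using 1
    simp only [mul_assoc, proj_mul_coproj_assoc,
      mul_zero, coproj_mul_self_assoc, proj_mul_self, proj_mul_self_assoc, sub_zero]
    rw [hpR]
    simp only [mul_add]
  · have h := hL _ (hL.coproj_mul_mul_proj_mem hN hP hT) _ (mul_mem (mul_mem hp hR) hp)
    have h1 : proj P * (S * coproj P * T * proj P * R) * coproj P ∈ bimodKV N L := by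
      have h2 : proj P * (S * coproj P * T * proj P * R) * coproj P ∈ L :=
        hL.corner_mul_mem hLc hN hP hT (fun h => by
          have : S * coproj P * T * proj P = S * (coproj P * T * proj P) := by
            simp only [mul_assoc]
          rw [this, h]; simp) rfl
      convert mem_bimodKV hP h2 using 1
      simp only [mul_assoc, proj_mul_self_assoc, coproj_mul_self]
    convert add_mem (bimodKD_le (mem_bimodKD hP h hS)) (bimodKV_le h1) using 1
    simp only [mul_assoc, proj_mul_coproj_assoc,
      mul_zero, coproj_mul_self_assoc, proj_mul_self, proj_mul_self_assoc, sub_zero]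
    rw [hpR]
    simp only [mul_add]
  · convert bimodKDelta_le (mem_bimodKDelta hP hT (mul_mem (mul_mem hS hq) hR)) using 1
    simp only [mul_assoc]
    rw [hqR]

lemma IsLieModule.mul_mem_bimodK' (hL : IsLieModule N L) (hLc : IsWeaklyClosed L) (hN : IsNest N)
    {K R : H →L[ℂ] H} (hK : K ∈ kernelGenerators N L) (hR : R ∈ nestAlgebra N) :
    R * K ∈ bimodK N L := by
  rcases hK with ((⟨P, hP, T, hT, rfl⟩ | ⟨P, hP, T, hT, rfl⟩) | ⟨P, hP, T, hT, S, hS, rfl⟩) |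
    ⟨P, hP, T, hT, S, hS, rfl⟩
  all_goals
    have hp := hN.proj_mem ⟨P, hP⟩
    have hq := hN.coproj_mem ⟨P, hP⟩
    have hRp : ∀ A, R * (proj P * A) = proj P * (R * (proj P * A)) :=
      mul_proj_mul_of_mem_nestAlgebra hR ⟨P, hP⟩
    have hRq : ∀ A, R * (coproj P * A) =
        proj P * (R * (coproj P * A)) + coproj P * (R * (coproj P * A)) := fun A => by
      rw [← add_mul, proj_add_coproj, one_mul]
  · have h := hL.commutator_sub_mem (hL.proj_mul_mul_coproj_mem hN hP hT)
      (mul_mem (mul_mem hp hR) hp)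
    convert bimodKV_le (mem_bimodKV hP h) using 1
    simp only [mul_assoc, coproj_mul_proj_assoc,
      mul_zero, coproj_mul_self, proj_mul_self_assoc, sub_zero]
    rw [hRp]
    simp only [proj_mul_self_assoc]
  · have h := hL.commutator_sub_mem (hL.coproj_mul_mul_proj_mem hN hP hT)
      (mul_mem (mul_mem hq hR) hq)
    convert add_mem (bimodKD_le (mem_bimodKD hP hT hR)) (bimodKL_le (mem_bimodKL hP h))
      using 1
    simp only [mul_assoc, proj_mul_coproj_assoc,
      mul_zero, coproj_mul_self_assoc, proj_mul_self, sub_zero]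
    rw [hRq]
    simp only [mul_add, proj_mul_self_assoc, coproj_mul_self_assoc, proj_mul_coproj_assoc,
      coproj_mul_proj_assoc, add_zero, zero_add]
  · convert bimodKD_le (mem_bimodKD hP hT (mul_mem (mul_mem hR hp) hS)) using 1
    simp only [mul_assoc]
    rw [hRp]
    simp only [proj_mul_self_assoc]
  · have h := hL.commutator_sub_mem (hL.coproj_mul_mul_proj_mem hN hP hT)
      (mul_mem (mul_mem hq hR) hq)
    have h1 : proj P * (R * coproj P * T * proj P * S) * coproj P ∈ bimodKV N L := by
      have h2 : proj P * (R * coproj P * T * proj P * S) * coproj P ∈ L :=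
        hL.corner_mul_mem hLc hN hP hT (fun h => by
          have : R * coproj P * T * proj P = R * (coproj P * T * proj P) := by
            simp only [mul_assoc]
          rw [this, h]; simp) rfl
      convert mem_bimodKV hP h2 using 1
      simp only [mul_assoc, proj_mul_self_assoc, coproj_mul_self]
    convert add_mem (bimodKV_le h1) (bimodKDelta_le (mem_bimodKDelta hP h hS)) using 1
    simp only [mul_assoc, proj_mul_coproj_assoc,
      mul_zero, coproj_mul_self_assoc, proj_mul_self_assoc, sub_zero]
    rw [hRq]
    simp only [mul_add, proj_mul_self_assoc, coproj_mul_self_assoc, proj_mul_coproj_assoc,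
      coproj_mul_proj_assoc, add_zero, zero_add]

theorem IsLieModule.isBimodule_bimodKClosure (hL : IsLieModule N L) (hLc : IsWeaklyClosed L)
    (hN : IsNest N) : IsBimodule N (bimodKClosure N L) := fun _ hT S hS =>
  ⟨mul_right_mem_of_mem_wspan (isWeaklyClosed_wspan _) S
      (fun _ hA => bimodK_le_bimodKClosure (hL.mul_mem_bimodK hLc hN hA hS)) hT,
    mul_left_mem_of_mem_wspan (isWeaklyClosed_wspan _) S
      (fun _ hA => bimodK_le_bimodKClosure (hL.mul_mem_bimodK' hLc hN hA hS)) hT⟩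

/-- The off-diagonal corners of a generator of `K(L)` are the corners of an element of `L`. -/
lemma IsLieModule.exists_corners_eq (hL : IsLieModule N L) (hN : IsNest N) (hP : P ∈ N)
    {K : H →L[ℂ] H} (hK : K ∈ kernelGenerators N L) :
    ∃ T ∈ L, proj P * K * coproj P = proj P * T * coproj P ∧
      coproj P * K * proj P = coproj P * T * proj P := by
  rcases hK with ((⟨Q, hQ, T, hT, rfl⟩ | ⟨Q, hQ, T, hT, rfl⟩) | ⟨Q, hQ, T, hT, S, hS, rfl⟩) |
    ⟨Q, hQ, T, hT, S, hS, rfl⟩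
  · exact ⟨_, hL.proj_mul_mul_coproj_mem hN hQ hT, rfl, rfl⟩
  · exact ⟨_, hL.coproj_mul_mul_proj_mem hN hQ hT, rfl, rfl⟩
  · rcases hN.total ⟨P, hP⟩ ⟨Q, hQ⟩ with h | h <;> replace h : _ ≤ _ := h
    · refine ⟨_, L.neg_mem (hL.corner_commutator_mem hN hQ hT S), ?_, ?_⟩
      · simp only [neg_sub, mul_sub, mul_assoc,
          mul_mul_eq_zero_of_mul_eq_zero (proj_mul_coproj_of_le h), sub_zero]
      · simp only [neg_sub, mul_sub, sub_mul, mul_assoc, coproj_mul_proj_of_le h, mul_zero,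
          sub_zero]
    · refine ⟨0, L.zero_mem, ?_, ?_⟩
      · simp only [mul_assoc, proj_mul_coproj_of_le h, mul_zero, zero_mul]
      · simp only [mul_assoc, mul_mul_eq_zero_of_mul_eq_zero (coproj_mul_proj_of_le h), mul_zero,
          zero_mul]
  · rcases hN.total ⟨P, hP⟩ ⟨Q, hQ⟩ with h | h <;> replace h : _ ≤ _ := h
    · refine ⟨0, L.zero_mem, ?_, ?_⟩
      · simp only [mul_assoc, mul_mul_eq_zero_of_mul_eq_zero (proj_mul_coproj_of_le h), mul_zero,
          zero_mul]
      · simp only [mul_assoc, coproj_mul_proj_of_le h, mul_zero, zero_mul]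
    · refine ⟨_, hL.corner_commutator_mem hN hQ hT S, ?_, ?_⟩
      · simp only [mul_sub, sub_mul, mul_assoc, proj_mul_coproj_of_le h, mul_zero, sub_zero]
      · simp only [mul_sub, mul_assoc,
          mul_mul_eq_zero_of_mul_eq_zero (coproj_mul_proj_of_le h), sub_zero]

section Closure

variable {A : H →L[ℂ] H}

lemma IsLieModule.mem_bimodKV_of_closure (hL : IsLieModule N L) (hN : IsNest N) (hP : P ∈ N)
    (hA : A ∈ bimodKClosure N L) : proj P * A * coproj P ∈ bimodKV N L := by
  refine mul_mul_mem_of_mem_wspan (isWeaklyClosed_wspan _) _ _ (fun K hK => ?_) hA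
  obtain ⟨T, hT, h, -⟩ := hL.exists_corners_eq hN hP hK
  rw [h]
  exact mem_bimodKV hP hT

lemma IsLieModule.mem_bimodKL_of_closure (hL : IsLieModule N L) (hN : IsNest N) (hP : P ∈ N)
    (hA : A ∈ bimodKClosure N L) : coproj P * A * proj P ∈ bimodKL N L := by
  refine mul_mul_mem_of_mem_wspan (isWeaklyClosed_wspan _) _ _ (fun K hK => ?_) hA
  obtain ⟨T, hT, -, h⟩ := hL.exists_corners_eq hN hP hK
  rw [h]
  exact mem_bimodKL hP hT

lemma IsLieModule.mem_bimodKD_of_closure (hL : IsLieModule N L) (hN : IsNest N) (hP : P ∈ N)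
    (hA : A ∈ bimodKClosure N L) {S : H →L[ℂ] H} (hS : S ∈ nestAlgebra N) :
    proj P * S * coproj P * A * proj P ∈ bimodKD N L := by
  refine mul_mul_mem_of_mem_wspan (isWeaklyClosed_wspan _) _ _ (fun K hK => ?_) hA
  obtain ⟨T, hT, -, h⟩ := hL.exists_corners_eq hN hP hK
  suffices h' : proj P * S * coproj P * K * proj P = proj P * S * coproj P * T * proj P by
    rw [h']
    exact mem_bimodKD hP hT hS
  simp only [mul_assoc] at h ⊢
  rw [h]

lemma IsLieModule.mem_bimodKDelta_of_closure (hL : IsLieModule N L) (hN : IsNest N) (hP : P ∈ N)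
    (hA : A ∈ bimodKClosure N L) {S : H →L[ℂ] H} (hS : S ∈ nestAlgebra N) :
    coproj P * A * proj P * S * coproj P ∈ bimodKDelta N L := by
  have := mul_mul_mem_of_mem_wspan (isWeaklyClosed_wspan _) (M := bimodKDelta N L) (coproj P)
    (proj P * S * coproj P) (fun K hK => ?_) hA
  · simpa only [mul_assoc] using this
  obtain ⟨T, hT, -, h⟩ := hL.exists_corners_eq hN hP hK
  suffices h' : coproj P * K * (proj P * S * coproj P) = coproj P * T * proj P * S * coproj P by
    rw [h']
    exact mem_bimodKDelta hP hT hS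
  simp only [← mul_assoc] at h ⊢
  rw [h]

/-- The diagonal blocks of `K(L)` at the atoms `B - C` of the nest, `B` and `C` both invariant under
`K(L)`, vanish. -/
lemma atom_block_eq_zero {B C : ClosedSubmodule ℂ H} (hB : B ∈ N) (hC : C ∈ N)
    (hCB : C ≤ B) (hBC : ∀ P ∈ N, P ≤ C ∨ B ≤ P)
    (h1 : ∀ T ∈ bimodKClosure N L, coproj B * T * proj B = 0)
    (h2 : ∀ T ∈ bimodKClosure N L, coproj C * T * proj C = 0)
    (hA : A ∈ bimodKClosure N L) :
    (proj B * coproj C) * A * (coproj C * proj B) = 0 := by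
  have key : ∀ {P T}, P ∈ N → T ∈ L → (∀ T ∈ bimodKClosure N L, coproj P * T * proj P = 0) →
      coproj P * T * proj P = 0 := fun {P T} hP hT h => by
    have := h _ (bimodK_le_bimodKClosure (bimodKL_le (mem_bimodKL hP hT)))
    simpa only [mul_assoc, coproj_mul_self_assoc, proj_mul_self] using this
  have hE : coproj C * proj B = proj B * coproj C := by
    rw [coproj, sub_mul, mul_sub, one_mul, mul_one, proj_mul_proj_of_le hCB,
      proj_mul_proj_of_ge hCB]
  have := mul_mul_mem_of_mem_wspan (M := ⊥) isWeaklyClosed_bot (proj B * coproj C)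
    (coproj C * proj B) (fun K hK => ?_) hA
  · simpa using this
  rw [Submodule.mem_bot]
  rcases hK with ((⟨P, hP, T, hT, rfl⟩ | ⟨P, hP, T, hT, rfl⟩) | ⟨P, hP, T, hT, S, hS, rfl⟩) |
    ⟨P, hP, T, hT, S, hS, rfl⟩ <;> rcases hBC P hP with h | h
  · have h3 : (proj B * coproj C) * proj P = 0 := by
      rw [mul_assoc, coproj_mul_proj_of_le h, mul_zero]
    simp only [← mul_assoc] at h3 ⊢
    simp only [h3, zero_mul]
  · have h3 : coproj P * (coproj C * proj B) = 0 := by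
      rw [← mul_assoc, coproj_mul_coproj_of_ge (hCB.trans h), coproj_mul_proj_of_le h]
    simp only [mul_assoc, h3, mul_zero]
  · have h3 : proj P * (coproj C * proj B) = 0 := by
      rw [← mul_assoc, proj_mul_coproj_of_le h, zero_mul]
    simp only [mul_assoc, h3, mul_zero]
  · have h3 : (proj B * coproj C) * coproj P = 0 := by
      rw [mul_assoc, coproj_mul_coproj_of_le (hCB.trans h), proj_mul_coproj_of_le h]
    simp only [← mul_assoc] at h3 ⊢
    simp only [h3, zero_mul]
  · have h3 : proj P * (coproj C * proj B) = 0 := by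
      rw [← mul_assoc, proj_mul_coproj_of_le h, zero_mul]
    simp only [mul_assoc, h3, mul_zero]
  · have h3 : coproj P * T * (proj P * (coproj C * proj B)) = 0 := by
      rw [hE, ← mul_assoc (proj P), proj_mul_proj_of_ge h, ← coproj_mul_coproj_of_ge h, ← mul_assoc,
        mul_assoc (coproj P), mul_assoc (coproj P), key hB hT h1, mul_zero, zero_mul]
    simp only [mul_assoc] at h3 ⊢
    simp only [h3, mul_zero]
  · have h3 : (proj B * coproj C) * coproj P * T * proj P = 0 := by
      rw [mul_assoc (proj B), coproj_mul_coproj_of_ge h, ← proj_mul_proj_of_ge h, ← mul_assoc,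
        mul_assoc (proj B), mul_assoc (proj B), key hC hT h2, mul_zero, zero_mul]
    simp only [← mul_assoc] at h3 ⊢
    simp only [h3, zero_mul]
  · have h3 : coproj P * (coproj C * proj B) = 0 := by
      rw [← mul_assoc, coproj_mul_coproj_of_ge (hCB.trans h), coproj_mul_proj_of_le h]
    simp only [mul_assoc, h3, mul_zero]

end Closure

end Lie

/-! ### Intervals of the nest and block diagonal sums -/

section Gap

variable {N : CompleteSublattice (ClosedSubmodule ℂ H)}

/-- The interval `P - Q = P ∧ Q^⊥`, as a closed subspace. -/
def gap (P Q : ClosedSubmodule ℂ H) : ClosedSubmodule ℂ H := P ⊓ orth Q.toSubmodule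

lemma mem_gap {P Q : ClosedSubmodule ℂ H} {x : H} : x ∈ gap P Q ↔ x ∈ P ∧ proj Q x = 0 := by
  rw [gap, ClosedSubmodule.mem_inf, mem_orth, proj_apply_eq_zero_iff]
  rfl

lemma gap_mono {P Q Q' : ClosedSubmodule ℂ H} (h : Q ≤ Q') : gap P Q' ≤ gap P Q := by
  intro x hx
  rw [mem_gap] at hx ⊢
  exact ⟨hx.1, proj_apply_eq_zero_iff.2 fun z hz => proj_apply_eq_zero_iff.1 hx.2 z (h hz)⟩

lemma commute_coproj_right {P Q : ClosedSubmodule ℂ H} (h : Commute (proj P) (proj Q)) :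
    Commute (proj P) (coproj Q) := (Commute.one_right _).sub_right h

lemma proj_gap {P Q : ClosedSubmodule ℂ H} (h : Commute (proj P) (proj Q)) :
    proj (gap P Q) = proj P * coproj Q := by
  ext x
  refine Submodule.eq_starProjection_of_mem_of_inner_eq_zero (K := (gap P Q).toSubmodule) ?_ ?_
  · refine mem_gap.2 ⟨proj_apply_mem _ _, ?_⟩
    rw [← mul_apply_eq_comp, (commute_coproj_right h).eq, ← mul_assoc, proj_mul_coproj, zero_mul,
      zero_apply]
  · intro w hw
    obtain ⟨hw1, hw2⟩ := mem_gap.1 hw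
    have h1 : ((proj P * coproj Q).adjoint) w = w := by
      rw [← ContinuousLinearMap.star_eq_adjoint, star_mul, star_proj, star_coproj, mul_apply_eq_comp,
        proj_apply_of_mem hw1, coproj_apply_eq_self_iff.2 hw2]
    rw [inner_sub_left, ← ContinuousLinearMap.adjoint_inner_right, h1, sub_self]

lemma IsNest.proj_gap (hN : IsNest N) (P Q : N) : proj (gap (P : ClosedSubmodule ℂ H) Q) =
    proj (P : ClosedSubmodule ℂ H) * coproj (Q : ClosedSubmodule ℂ H) :=
  NestAlg.proj_gap (hN.commute_proj P Q)

lemma IsNest.proj_gap_mem (hN : IsNest N) (P Q : N) :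
    proj (gap (P : ClosedSubmodule ℂ H) Q) ∈ nestAlgebra N := by
  rw [hN.proj_gap]
  exact mul_mem (hN.proj_mem P) (hN.coproj_mem Q)

lemma proj_mul_proj_eq_zero_of_inner {E F : ClosedSubmodule ℂ H}
    (h : ∀ x ∈ E, ∀ y ∈ F, ⟪x, y⟫_ℂ = 0) : proj E * proj F = 0 := by
  ext x
  exact proj_apply_eq_zero_iff.2 fun z hz => h z hz _ (proj_apply_mem _ _)

lemma inner_eq_zero_of_mem_gap {P Q P' Q' : ClosedSubmodule ℂ H} (h : P ≤ Q') :
    ∀ x ∈ gap P Q, ∀ y ∈ gap P' Q', ⟪x, y⟫_ℂ = 0 := fun _ hx _ hy =>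
  proj_apply_eq_zero_iff.1 (mem_gap.1 hy).2 _ (h (mem_gap.1 hx).1)

lemma norm_sq_sum_of_orthogonal {ι : Type*} (s : Finset ι) (v : ι → H)
    (hv : ∀ i j, i ≠ j → ⟪v i, v j⟫_ℂ = 0) : ‖∑ i ∈ s, v i‖ ^ 2 = ∑ i ∈ s, ‖v i‖ ^ 2 := by
  have h : ⟪∑ i ∈ s, v i, ∑ i ∈ s, v i⟫_ℂ = ∑ i ∈ s, ⟪v i, v i⟫_ℂ := by
    rw [sum_inner]
    refine Finset.sum_congr rfl fun i hi => ?_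
    rw [inner_sum]
    exact Finset.sum_eq_single i (fun j _ hj => hv i j hj.symm) (fun h => absurd hi h)
  simp only [inner_self_eq_norm_sq_to_K] at h
  exact_mod_cast h

/-- For pairwise orthogonal families `E i` and `F i` the block diagonal sum `∑ E i A F i` exists as a
weak limit of its finite partial sums, whose norms are at most `‖A‖`. -/
lemma exists_block_sum {ι : Type*} {E F : ι → ClosedSubmodule ℂ H}
    (hE : ∀ i j, i ≠ j → ∀ x ∈ E i, ∀ y ∈ E j, ⟪x, y⟫_ℂ = 0)
    (hF : ∀ i j, i ≠ j → ∀ x ∈ F i, ∀ y ∈ F j, ⟪x, y⟫_ℂ = 0)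
    {V : Submodule ℂ (H →L[ℂ] H)} (hV : IsWeaklyClosed V) (A : H →L[ℂ] H)
    (h : ∀ i, proj (E i) * A * proj (F i) ∈ V) :
    ∃ C ∈ V, ∀ i, proj (E i) * C = proj (E i) * A * proj (F i) := by
  classical
  let T : Finset ι → (H →L[ℂ] H) := fun s => ∑ i ∈ s, proj (E i) * A * proj (F i)
  have hTx : ∀ s x, T s x = ∑ i ∈ s, proj (E i) (A (proj (F i) x)) := fun s x => by
    simp [T]
  have hFx : ∀ (s : Finset ι) x, ∑ i ∈ s, ‖proj (F i) x‖ ^ 2 ≤ ‖x‖ ^ 2 := by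
    intro s x
    have h1 := norm_sq_sum_of_orthogonal s (fun i => proj (F i) x) fun i j hij =>
      hF i j hij _ (proj_apply_mem _ _) _ (proj_apply_mem _ _)
    have h2 : ⟪∑ i ∈ s, proj (F i) x, x⟫_ℂ = ((∑ i ∈ s, ‖proj (F i) x‖ ^ 2 : ℝ) : ℂ) := by
      rw [sum_inner]
      push_cast
      refine Finset.sum_congr rfl fun i _ => ?_
      rw [inner_proj_self, inner_self_eq_norm_sq_to_K]
      rfl
    have h3 := norm_inner_le_norm (𝕜 := ℂ) (∑ i ∈ s, proj (F i) x) x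
    rw [h2, Complex.norm_real, Real.norm_eq_abs, abs_of_nonneg (by positivity), ← h1] at h3
    rw [← h1]
    have h4 : ‖∑ i ∈ s, proj (F i) x‖ ≤ ‖x‖ := by
      by_contra! h5
      nlinarith [norm_nonneg x]
    gcongr
  have hT : ∀ s, ‖T s‖ ≤ ‖A‖ := by
    intro s
    refine ContinuousLinearMap.opNorm_le_bound _ (norm_nonneg _) fun x => ?_
    refine le_of_sq_le_sq ?_ (by positivity)
    rw [hTx, norm_sq_sum_of_orthogonal s _ fun i j hij =>
      hE i j hij _ (proj_apply_mem _ _) _ (proj_apply_mem _ _)]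
    calc ∑ i ∈ s, ‖proj (E i) (A (proj (F i) x))‖ ^ 2
        ≤ ∑ i ∈ s, ‖A‖ ^ 2 * ‖proj (F i) x‖ ^ 2 := by
          refine Finset.sum_le_sum fun i _ => ?_
          rw [← mul_pow]
          gcongr
          calc ‖proj (E i) (A (proj (F i) x))‖ ≤ 1 * ‖A (proj (F i) x)‖ :=
                (proj (E i)).le_of_opNorm_le (norm_proj_le _) _
            _ ≤ ‖A‖ * ‖proj (F i) x‖ := by rw [one_mul]; exact A.le_opNorm _
      _ ≤ (‖A‖ * ‖x‖) ^ 2 := by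
          rw [← Finset.mul_sum, mul_pow]
          gcongr
          exact hFx s x
  let U : Ultrafilter (Finset ι) := Ultrafilter.of atTop
  obtain ⟨C, hC⟩ := exists_wot_limit U T hT
  refine ⟨C, hV.mem_of_tendsto hC (Eventually.of_forall fun s =>
    Submodule.sum_mem _ fun i _ => h i), fun i => ?_⟩
  ext y
  refine ext_inner_left ℂ fun x => ?_
  rw [mul_apply_eq_comp, ← inner_proj_left]
  refine tendsto_nhds_unique (hC _ y) (tendsto_const_nhds.congr' ?_)
  have hev : ∀ᶠ s in (U : Filter (Finset ι)), i ∈ s :=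
    (Ultrafilter.of_le atTop) ((eventually_ge_atTop {i}).mono fun s hs => by simpa using hs)
  refine hev.mono fun s hs => ?_
  change ⟪x, (proj (E i) * A * proj (F i)) y⟫_ℂ = ⟪proj (E i) x, T s y⟫_ℂ
  rw [inner_proj_left, hTx, map_sum, Finset.sum_eq_single i]
  · simp only [mul_apply_eq_comp]
    rw [← mul_apply_eq_comp (proj (E i)) (proj (E i)), proj_mul_self]
  · intro j _ hj
    rw [← mul_apply_eq_comp, proj_mul_proj_eq_zero_of_inner (hE i j hj.symm), zero_apply]
  · exact fun h => absurd hs h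

lemma isWeaklyClosed_inf {M M' : Submodule ℂ (H →L[ℂ] H)} (h : IsWeaklyClosed M)
    (h' : IsWeaklyClosed M') : IsWeaklyClosed (M ⊓ M') := IsClosed.inter h h'

lemma IsWeaklyClosed.comap_mul {M : Submodule ℂ (H →L[ℂ] H)} (hM : IsWeaklyClosed M)
    (S R : H →L[ℂ] H) : IsWeaklyClosed (M.comap (LinearMap.mulLeftRight ℂ (S, R))) := by
  refine hM.comap _ fun x y => ?_
  have := continuous_inner_apply_wot (R x) (S.adjoint y)
  simpa [ContinuousLinearMap.adjoint_inner_left, LinearMap.mulLeftRight_apply] using this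

lemma isWeaklyClosed_nestAlgebra :
    IsWeaklyClosed (Subalgebra.toSubmodule (nestAlgebra N)) := by
  have : {A : H →WOT[ℂ] H | A.toCLM ∈ Subalgebra.toSubmodule (nestAlgebra N)} =
      ⋂ P : N, {A : H →WOT[ℂ] H | A.toCLM ∈ (⊥ : Submodule ℂ (H →L[ℂ] H)).comap
        (LinearMap.mulLeftRight ℂ (coproj (P : ClosedSubmodule ℂ H),
          proj (P : ClosedSubmodule ℂ H)))} := by
    ext A
    simp only [Set.mem_iInter, Set.mem_ofPred_eq, Submodule.mem_comap, Submodule.mem_bot,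
      LinearMap.mulLeftRight_apply, Subalgebra.mem_toSubmodule]
    exact ⟨fun h P => coproj_mul_mul_proj h P, mem_nestAlgebra_of_coproj_mul_mul_proj⟩
  rw [IsWeaklyClosed, this]
  exact isClosed_iInter fun P => isWeaklyClosed_bot.comap_mul _ _

lemma mem_nestAlgebra_of_commute {T : H →L[ℂ] H}
    (h : ∀ P : N, Commute T (proj (P : ClosedSubmodule ℂ H))) : T ∈ nestAlgebra N := by
  refine mem_nestAlgebra_of_coproj_mul_mul_proj fun P => ?_
  rw [mul_assoc, (h P).eq, ← mul_assoc, coproj_mul_proj, zero_mul]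

end Gap

/-! ### The edge of a bimodule -/

section Edge

variable {N : CompleteSublattice (ClosedSubmodule ℂ H)} {M D : Submodule ℂ (H →L[ℂ] H)}

variable (N M) in
/-- The largest `Q` in the nest such that `M` maps `Q` into `P`. It is smaller than `P` exactly
when `M` does not leave `P` invariant. -/
def edge (P : N) : N :=
  sSup {Q : N | ∀ T ∈ M, ∀ x ∈ (Q : ClosedSubmodule ℂ H), T x ∈ (P : ClosedSubmodule ℂ H)}

lemma apply_mem_of_mem_edge {P : N} {T : H →L[ℂ] H} (hT : T ∈ M) {x : H}
    (hx : x ∈ (edge N M P : ClosedSubmodule ℂ H)) : T x ∈ (P : ClosedSubmodule ℂ H) := by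
  have : (edge N M P : ClosedSubmodule ℂ H) ≤ (P : ClosedSubmodule ℂ H).comap T :=
    coe_sSup_le fun Q hQ x hx => hQ T hT x hx
  exact this hx

lemma le_edge {P Q : N}
    (h : ∀ T ∈ M, ∀ x ∈ (Q : ClosedSubmodule ℂ H), T x ∈ (P : ClosedSubmodule ℂ H)) :
    Q ≤ edge N M P := le_sSup h

lemma edge_mono {P Q : N} (h : P ≤ Q) : edge N M P ≤ edge N M Q :=
  le_edge fun _ hT _ hx => h (apply_mem_of_mem_edge hT hx)

lemma coproj_mul_mul_proj_of_le_edge {P : N} (h : P ≤ edge N M P) {T : H →L[ℂ] H} (hT : T ∈ M) :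
    coproj (P : ClosedSubmodule ℂ H) * T * proj (P : ClosedSubmodule ℂ H) = 0 := by
  ext x
  exact coproj_apply_eq_zero_iff.2 (apply_mem_of_mem_edge hT (h (proj_apply_mem _ x)))

/-- The adjoints of `M` map `P^⊥` into the complement of the edge of `P`. -/
lemma proj_edge_adjoint_apply {P : N} {T : H →L[ℂ] H} (hT : T ∈ M) {x : H}
    (hx : proj (P : ClosedSubmodule ℂ H) x = 0) :
    proj (edge N M P : ClosedSubmodule ℂ H) (T.adjoint x) = 0 := by
  rw [proj_apply_eq_zero_iff]
  intro z hz
  rw [ContinuousLinearMap.adjoint_inner_right]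
  exact proj_apply_eq_zero_iff.1 hx _ (apply_mem_of_mem_edge hT hz)

/-- The vectors `u` such that `u ⊗ v ∈ D`. -/
def rankOneSlice (D : Submodule ℂ (H →L[ℂ] H)) (hD : IsWeaklyClosed D) (v : H) :
    ClosedSubmodule ℂ H where
  carrier := {u | rankOne ℂ v u ∈ D}
  add_mem' {a b} ha hb := by
    simp only [Set.mem_ofPred_eq, map_add] at *
    exact D.add_mem ha hb
  zero_mem' := by simp
  smul_mem' c u hu := by
    simp only [Set.mem_ofPred_eq, map_smulₛₗ] at *
    exact D.smul_mem _ hu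
  isClosed' := by
    exact hD.isClosed.preimage (rankOne ℂ v : H →L⋆[ℂ] H →L[ℂ] H).continuous

lemma mem_rankOneSlice {hD : IsWeaklyClosed D} {u v : H} :
    u ∈ rankOneSlice D hD v ↔ rankOne ℂ v u ∈ D := Iff.rfl

/-- Let `D` contain all `P S P^⊥ T P`. The closed span of the vectors `T* x`, `T ∈ M`, `x ∈ P^⊥`,
is invariant under the adjoints of the nest algebra and is therefore the complement of the edge of
`P`; hence `u ⊗ v ∈ D` for all `v ∈ P` and all `u` in the interval from the edge of `P` to `P`. -/
lemma IsNest.rankOne_mem_of_mem_gap_edge (hN : IsNest N) (hM : IsBimodule N M)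
    (hDc : IsWeaklyClosed D)
    (hD : ∀ P ∈ N, ∀ T ∈ M, ∀ S ∈ nestAlgebra N, proj P * S * coproj P * T * proj P ∈ D)
    {P : N} {u v : H} (hv : v ∈ (P : ClosedSubmodule ℂ H))
    (hu : u ∈ gap (P : ClosedSubmodule ℂ H) (edge N M P)) : rankOne ℂ v u ∈ D := by
  obtain ⟨huP, hue⟩ := mem_gap.1 hu
  let X : Set H := {w | ∃ T ∈ M, ∃ x, proj (P : ClosedSubmodule ℂ H) x = 0 ∧ w = T.adjoint x}
  let V : ClosedSubmodule ℂ H := (Submodule.span ℂ X).closure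
  have hXV : ∀ w ∈ X, w ∈ V := fun w hw => subset_closure (Submodule.subset_span hw)
  have hVle : ∀ {Z : ClosedSubmodule ℂ H}, (∀ w ∈ X, w ∈ Z) → V ≤ Z := fun h =>
    Submodule.closure_le.2 (Submodule.span_le.2 h)
  obtain ⟨W, hW⟩ := hN.exists_of_adjoint_invariant V fun S hS v hv => by
    have : V ≤ V.comap S.adjoint := hVle fun w ⟨T, hT, x, hx, hw⟩ => by
      rw [ClosedSubmodule.mem_comap]
      refine hXV _ ⟨T * S, (hM T hT S hS).1, x, hx, ?_⟩
      rw [hw, ← ContinuousLinearMap.star_eq_adjoint, ← ContinuousLinearMap.star_eq_adjoint,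
        ← ContinuousLinearMap.star_eq_adjoint, star_mul, mul_apply_eq_comp]
    exact this hv
  have hWe : W ≤ edge N M P := le_edge fun T hT z hz => by
    rw [← coproj_apply_eq_zero_iff, ← inner_self_eq_zero (𝕜 := ℂ), ← inner_coproj_self,
      ← ContinuousLinearMap.adjoint_inner_left, ← inner_conj_symm]
    have := (hW _).1 (hXV _ ⟨T, hT, coproj (P : ClosedSubmodule ℂ H) (T z),
      proj_coproj_apply _ _, rfl⟩)
    rw [proj_apply_eq_zero_iff.1 this z hz, map_zero]
  have huV : u ∈ V := (hW u).2 <|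
    proj_apply_eq_zero_iff.2 fun z hz => proj_apply_eq_zero_iff.1 hue z (hWe hz)
  have : V ≤ (rankOneSlice D hDc v).comap (proj (P : ClosedSubmodule ℂ H)) :=
    hVle fun w ⟨T, hT, x, hx, hw⟩ => by
      rw [ClosedSubmodule.mem_comap, mem_rankOneSlice]
      have hx' : proj (pred N P : ClosedSubmodule ℂ H) x = 0 :=
        proj_apply_eq_zero_iff.2 fun z hz => proj_apply_eq_zero_iff.1 hx z (pred_le P hz)
      convert hD P P.2 T hT _ (hN.rankOne_mem hv hx') using 1
      rw [mul_rankOne, proj_apply_of_mem hv, rankOne_mul, adjoint_coproj,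
        coproj_apply_eq_self_iff.2 hx, rankOne_mul, rankOne_mul, adjoint_proj, hw]
  have h1 := this huV
  rwa [ClosedSubmodule.mem_comap, mem_rankOneSlice, proj_apply_of_mem huP] at h1

variable (N M) in
/-- The closed span of all the intervals from the edge of `P` to `P`. Its complement is carried by
the intervals of the nest all of whose elements are invariant under `M`. -/
def activeSpace : ClosedSubmodule ℂ H :=
  ⨆ P : N, gap (P : ClosedSubmodule ℂ H) (edge N M P)

lemma gap_edge_le_activeSpace (P : N) :
    gap (P : ClosedSubmodule ℂ H) (edge N M P) ≤ activeSpace N M :=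
  le_iSup (fun P : N => gap (P : ClosedSubmodule ℂ H) (edge N M P)) P

lemma proj_apply_mem_gap {P Q R : ClosedSubmodule ℂ H} (h : Commute (proj R) (proj P))
    (h' : Commute (proj R) (proj Q)) {x : H} (hx : x ∈ gap P Q) : proj R x ∈ gap P Q := by
  obtain ⟨h1, h2⟩ := mem_gap.1 hx
  refine mem_gap.2 ⟨?_, ?_⟩
  · rw [← proj_apply_eq_self_iff, ← mul_apply_eq_comp, ← h.eq, mul_apply_eq_comp,
      proj_apply_of_mem h1]
  · rw [← mul_apply_eq_comp, ← h'.eq, mul_apply_eq_comp, h2, map_zero]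

lemma IsNest.commute_proj_activeSpace (hN : IsNest N) (P : N) :
    Commute (proj (activeSpace N M)) (proj (P : ClosedSubmodule ℂ H)) := by
  have hinv : activeSpace N M ≤ (activeSpace N M).comap (proj (P : ClosedSubmodule ℂ H)) :=
    iSup_le fun Q x hx => gap_edge_le_activeSpace Q
      (proj_apply_mem_gap (hN.commute_proj _ _) (hN.commute_proj _ _) hx)
  have h1 : proj (activeSpace N M) * (proj (P : ClosedSubmodule ℂ H) * proj (activeSpace N M)) =
      proj (P : ClosedSubmodule ℂ H) * proj (activeSpace N M) := by
    ext x
    exact proj_apply_of_mem (hinv (proj_apply_mem _ x))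
  have h2 := congrArg star h1
  simp only [star_mul, star_proj] at h2
  rw [mul_assoc] at h2
  exact h2.symm.trans h1

lemma IsNest.proj_activeSpace_mem (hN : IsNest N) : proj (activeSpace N M) ∈ nestAlgebra N :=
  mem_nestAlgebra_of_commute hN.commute_proj_activeSpace

lemma IsNest.coproj_activeSpace_mem (hN : IsNest N) : coproj (activeSpace N M) ∈ nestAlgebra N :=
  sub_mem (one_mem _) hN.proj_activeSpace_mem

/-- A vector of `P` orthogonal to the active space lies in the largest `M`-invariant element of the
nest below `P`. Consequently `M` acts on the complement of the active space by elements of the nest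
algebra. -/
lemma IsNest.mul_coproj_activeSpace_mem (hN : IsNest N) {A : H →L[ℂ] H} (hA : A ∈ M) :
    A * coproj (activeSpace N M) ∈ nestAlgebra N := by
  rw [mem_nestAlgebra_iff]
  intro P y hy
  set x := coproj (activeSpace N M) y with hx
  have hxP : x ∈ (P : ClosedSubmodule ℂ H) := hN.coproj_activeSpace_mem P P.2 y hy
  have hx0 : proj (activeSpace N M) x = 0 := proj_coproj_apply _ _
  set R := lowerProj N x with hR
  have hRe : R ≤ edge N M R := by
    refine lowerProj_le ?_
    rw [← coproj_apply_eq_zero_iff, ← inner_self_eq_zero (𝕜 := ℂ), ← inner_coproj_self]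
    refine proj_apply_eq_zero_iff.1 hx0 _ (gap_edge_le_activeSpace R (mem_gap.2 ⟨?_, ?_⟩))
    · exact hN.coproj_mem _ R R.2 _ (mem_lowerProj x)
    · exact proj_coproj_apply _ _
  exact lowerProj_le hxP (apply_mem_of_mem_edge hA (hRe (mem_lowerProj x)))

/-- An operator of `M ∩ T(N)` all of whose diagonal blocks at the atoms of the nest vanish is a
weak limit of combinations of operators `P T P^⊥`, `T ∈ M`. -/
lemma IsNest.mem_of_atom_blocks_eq_zero (hN : IsNest N) (hM : IsBimodule N M)
    (hDc : IsWeaklyClosed D) (hD : ∀ P ∈ N, ∀ T ∈ M, proj P * T * coproj P ∈ D)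
    {U : H →L[ℂ] H} (hUM : U ∈ M) (hU : U ∈ nestAlgebra N)
    (h : ∀ B : N, proj (gap (B : ClosedSubmodule ℂ H) (pred N B)) * U *
      proj (gap (B : ClosedSubmodule ℂ H) (pred N B)) = 0) : U ∈ D := by
  refine hN.mem_of_rankOne_right hDc fun P x y hy hx => ?_
  have hUy : U y ∈ (P : ClosedSubmodule ℂ H) := hU P P.2 y hy
  have hUy' : U y ∈ (pred N P : ClosedSubmodule ℂ H) := by
    have h1 : U y = U (proj (gap (P : ClosedSubmodule ℂ H) (pred N P)) y) +
        U (proj (pred N P : ClosedSubmodule ℂ H) y) := by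
      rw [← map_add, hN.proj_gap, (commute_coproj_right (hN.commute_proj P (pred N P))).eq,
        mul_apply_eq_comp, proj_apply_of_mem hy, coproj_apply, sub_add_cancel]
    have h2 : proj (gap (P : ClosedSubmodule ℂ H) (pred N P)) (U y) = 0 := by
      rw [h1, map_add]
      have := DFunLike.congr_fun (h P) y
      simp only [mul_apply_eq_comp, zero_apply] at this
      rw [this, zero_add, proj_apply_eq_zero_iff]
      intro z hz
      have h3 : U (proj (pred N P : ClosedSubmodule ℂ H) y) ∈ (pred N P : ClosedSubmodule ℂ H) :=
        hU _ (pred N P).2 _ (proj_apply_mem _ _)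
      rw [← inner_conj_symm, proj_apply_eq_zero_iff.1 (mem_gap.1 hz).2 _ h3, map_zero]
    rw [hN.proj_gap, (commute_coproj_right (hN.commute_proj P (pred N P))).eq,
      mul_apply_eq_comp, proj_apply_of_mem hUy] at h2
    exact coproj_apply_eq_zero_iff.1 h2
  have hR := (hM U hUM _ (hN.rankOne_mem hy hx)).1
  convert hD (pred N P) (pred N P).2 _ hR using 1
  rw [mul_rankOne, mul_rankOne, rankOne_mul, adjoint_coproj, proj_apply_of_mem hUy',
    coproj_apply_eq_self_iff.2 hx]

end Edge

/-! ### `K(L)` is weakly closed -/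

section KClosed

variable {N : CompleteSublattice (ClosedSubmodule ℂ H)} {M D L : Submodule ℂ (H →L[ℂ] H)}

/-- Let `C` have, in the row of each atom `P - P_-`, the block of `A` in the columns strictly below
the atom and between the edges of `P_-` and `P`. What remains of `A` in the columns of the active
space then belongs to every weakly closed `D` containing all `P S P^⊥ T P`, `T ∈ M`: a row
`(A - C)* x` with `x ⊥ P_-` splits into a part orthogonal to the edge of `P` and a part orthogonal
to `P_-`. -/
lemma IsNest.mul_proj_activeSpace_mem (hN : IsNest N) (hM : IsBimodule N M)
    (hDc : IsWeaklyClosed D)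
    (hD : ∀ P ∈ N, ∀ T ∈ M, ∀ S ∈ nestAlgebra N, proj P * S * coproj P * T * proj P ∈ D)
    {A C : H →L[ℂ] H} (hA : A ∈ M) (hC : C ∈ M)
    (hAC : ∀ P : N, proj (gap (P : ClosedSubmodule ℂ H) (pred N P)) * C =
      proj (gap (P : ClosedSubmodule ℂ H) (pred N P)) * A *
        proj (gap ((edge N M P ⊓ pred N P : N) : ClosedSubmodule ℂ H) (edge N M (pred N P)))) :
    (A - C) * proj (activeSpace N M) ∈ D := by
  have hX : ∀ (Q : N) z, proj (Q : ClosedSubmodule ℂ H) (proj (activeSpace N M) z) =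
      proj (activeSpace N M) (proj (Q : ClosedSubmodule ℂ H) z) := fun Q z => by
    rw [← mul_apply_eq_comp, ← (hN.commute_proj_activeSpace Q).eq, mul_apply_eq_comp]
  refine hN.mem_of_rankOne_left hDc fun P x y hy hx => ?_
  have hpred : ∀ z, proj (pred N P : ClosedSubmodule ℂ H) z = 0 →
      proj (activeSpace N M) z ∈ rankOneSlice D hDc y := by
    intro z hz
    have hle : activeSpace N M ≤
        (rankOneSlice D hDc y).comap (coproj (pred N P : ClosedSubmodule ℂ H)) := by
      refine iSup_le fun Q t ht => ?_
      rw [ClosedSubmodule.mem_comap]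
      by_cases hQ : Q ≤ pred N P
      · rw [coproj_apply_eq_zero_iff.2 (hQ (mem_gap.1 ht).1)]
        exact zero_mem _
      · have hPQ : P ≤ Q := hN.le_of_not_lt fun h => hQ (le_pred h)
        refine hN.rankOne_mem_of_mem_gap_edge hM hDc hD (hPQ hy) ?_
        exact (gap (Q : ClosedSubmodule ℂ H) (edge N M Q)).toSubmodule.sub_mem ht
          (proj_apply_mem_gap (hN.commute_proj _ _) (hN.commute_proj _ _) ht)
    have h1 := hle (proj_apply_mem _ z)
    rwa [ClosedSubmodule.mem_comap, coproj_apply_eq_self_iff.2 (by rw [hX, hz, map_zero])] at h1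
  have hedge : ∀ z, proj (edge N M P : ClosedSubmodule ℂ H) z = 0 →
      proj (activeSpace N M) z ∈ rankOneSlice D hDc y := by
    intro z hz
    have h1 : proj (activeSpace N M) z =
        proj (P : ClosedSubmodule ℂ H) (proj (activeSpace N M) z) +
          proj (activeSpace N M) (coproj (P : ClosedSubmodule ℂ H) z) := by
      rw [hX, ← map_add, coproj_apply, add_sub_cancel]
    rw [h1]
    refine add_mem ?_ (hpred _ ?_)
    · refine hN.rankOne_mem_of_mem_gap_edge hM hDc hD hy (mem_gap.2 ⟨proj_apply_mem _ _, ?_⟩)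
      rw [← mul_apply_eq_comp, (hN.commute_proj _ _).eq, mul_apply_eq_comp, hX, hz, map_zero,
        map_zero]
    · rw [← mul_apply_eq_comp, proj_mul_coproj_of_le (pred_le P), zero_apply]
  have hadj : ((A - C) * proj (activeSpace N M)).adjoint x =
      proj (activeSpace N M) ((A - C).adjoint x) := by
    rw [← ContinuousLinearMap.star_eq_adjoint, star_mul, star_proj, mul_apply_eq_comp,
      ContinuousLinearMap.star_eq_adjoint]
  rw [hadj]
  change proj (activeSpace N M) ((A - C).adjoint x) ∈ rankOneSlice D hDc y
  have hxs : x = coproj (P : ClosedSubmodule ℂ H) x + proj (P : ClosedSubmodule ℂ H) x := by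
    rw [coproj_apply, sub_add_cancel]
  rw [hxs, map_add, map_add]
  refine add_mem (hedge _ (proj_edge_adjoint_apply (sub_mem hA hC) (proj_coproj_apply _ _))) ?_
  set e := proj (P : ClosedSubmodule ℂ H) x with he
  set E := proj (gap (P : ClosedSubmodule ℂ H) (pred N P)) with hE
  set G : N := edge N M P ⊓ pred N P with hG
  have hep : proj (pred N P : ClosedSubmodule ℂ H) e = 0 := by
    rw [he, ← mul_apply_eq_comp, (hN.commute_proj _ _).eq, mul_apply_eq_comp, hx, map_zero]
  have hEe : E e = e := proj_apply_of_mem (mem_gap.2 ⟨proj_apply_mem _ _, hep⟩)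
  have hv : proj (edge N M (pred N P) : ClosedSubmodule ℂ H) (A.adjoint e) = 0 :=
    proj_edge_adjoint_apply hA hep
  have hCe : C.adjoint e = proj (G : ClosedSubmodule ℂ H) (A.adjoint e) := by
    have h1 := congrArg star (hAC P)
    rw [star_mul, star_mul, star_mul, star_proj, star_proj, ContinuousLinearMap.star_eq_adjoint,
      ContinuousLinearMap.star_eq_adjoint] at h1
    have h2 := DFunLike.congr_fun h1 e
    rw [mul_apply_eq_comp, mul_apply_eq_comp, mul_apply_eq_comp, hEe, hN.proj_gap,
      mul_apply_eq_comp, coproj_apply_eq_self_iff.2 hv] at h2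
    exact h2
  have hw : (A - C).adjoint e = coproj (G : ClosedSubmodule ℂ H) (A.adjoint e) := by
    rw [map_sub, sub_apply, hCe, coproj_apply]
  rw [hw]
  rcases hN.total (edge N M P) (pred N P) with h | h
  · refine hedge _ ?_
    rw [hG, inf_eq_left.2 h]
    exact proj_coproj_apply _ _
  · refine hpred _ ?_
    rw [hG, inf_eq_right.2 h]
    exact proj_coproj_apply _ _

/-- At an atom `B - B_-` with `B_-` not invariant under `M`, all of `(B - B_-) B(H) (B - B_-)`
is produced by operators `P^⊥ T P S P^⊥` with `P = B_-`. -/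
lemma IsNest.atom_block_mem (hN : IsNest N) (hM : IsBimodule N M) (hDc : IsWeaklyClosed D)
    (hD : ∀ P ∈ N, ∀ T ∈ M, ∀ S ∈ nestAlgebra N, coproj P * T * proj P * S * coproj P ∈ D)
    {B : N} (hC : ¬ pred N B ≤ edge N M (pred N B)) (A : H →L[ℂ] H) :
    proj (gap (B : ClosedSubmodule ℂ H) (pred N B)) * A *
      proj (gap (B : ClosedSubmodule ℂ H) (pred N B)) ∈ D := by
  obtain ⟨T, hT, z, hz, hTz⟩ : ∃ T ∈ M, ∃ z ∈ (pred N B : ClosedSubmodule ℂ H),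
      T z ∉ (pred N B : ClosedSubmodule ℂ H) := by
    by_contra! h
    exact hC (le_edge h)
  set v := coproj (pred N B : ClosedSubmodule ℂ H) (T z) with hv
  have hv0 : ⟪v, T z⟫_ℂ ≠ 0 := by
    rw [hv, inner_coproj_self, inner_self_ne_zero]
    exact fun h => hTz (coproj_apply_eq_zero_iff.1 h)
  suffices h : ∀ x y, proj (gap (B : ClosedSubmodule ℂ H) (pred N B)) * rankOne ℂ y x *
      proj (gap (B : ClosedSubmodule ℂ H) (pred N B)) ∈ D from hDc.mul_mul_mem h A
  intro x y
  rw [mul_rankOne, rankOne_mul, adjoint_proj]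
  obtain ⟨hx1, hx2⟩ := mem_gap.1 (proj_apply_mem (gap (B : ClosedSubmodule ℂ H) (pred N B)) x)
  obtain ⟨hy1, hy2⟩ := mem_gap.1 (proj_apply_mem (gap (B : ClosedSubmodule ℂ H) (pred N B)) y)
  set x' := proj (gap (B : ClosedSubmodule ℂ H) (pred N B)) x
  set y' := proj (gap (B : ClosedSubmodule ℂ H) (pred N B)) y
  have h1 : rankOne ℂ y' v ∈ nestAlgebra N := hN.rankOne_mem hy1 (proj_coproj_apply _ _)
  have h2 : rankOne ℂ z x' ∈ nestAlgebra N := hN.rankOne_mem (pred_le B hz) hx2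
  have h3 := hD _ (pred N B).2 _ (hM T hT _ h1).2 _ h2
  have h4 : coproj (pred N B : ClosedSubmodule ℂ H) * (rankOne ℂ y' v * T) *
      proj (pred N B : ClosedSubmodule ℂ H) * rankOne ℂ z x' *
      coproj (pred N B : ClosedSubmodule ℂ H) = ⟪v, T z⟫_ℂ • rankOne ℂ y' x' := by
    rw [mul_rankOne, rankOne_mul, adjoint_coproj, coproj_apply_eq_self_iff.2 hx2]
    simp only [mul_apply_eq_comp, proj_apply_of_mem hz, rankOne_apply, map_smul, smul_apply,
      coproj_apply_eq_self_iff.2 hy2]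
  rw [h4] at h3
  exact (D.smul_mem_iff hv0).1 h3

lemma IsNest.gap_orthogonal (hN : IsNest N) {E F : N → N} (h : ∀ P Q, P < Q → E P ≤ F Q)
    (P Q : N) (hPQ : P ≠ Q) : ∀ x ∈ gap (E P : ClosedSubmodule ℂ H) (F P),
      ∀ y ∈ gap (E Q : ClosedSubmodule ℂ H) (F Q), ⟪x, y⟫_ℂ = 0 := by
  intro x hx y hy
  rcases hN.total P Q with h' | h'
  · exact inner_eq_zero_of_mem_gap (h P Q (lt_of_le_of_ne h' hPQ)) x hx y hy
  · rw [← inner_conj_symm,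
      inner_eq_zero_of_mem_gap (h Q P (lt_of_le_of_ne h' hPQ.symm)) y hy x hx, map_zero]

/-- The weak closure of `K(L)` is `K(L)`. An operator `A` of the closure is a sum of four parts. In
the columns outside the active space it is upper triangular; its diagonal blocks at the atoms form
a block diagonal operator in `K_Δ` and the rest is in `K_V`. In the columns of the active space, the
rows of the atoms in which `A` touches its edge contribute a block sum in `K_L`, and the rest is in
`K_D`. -/
theorem IsLieModule.bimodKClosure_le (hL : IsLieModule N L) (hLc : IsWeaklyClosed L)
    (hN : IsNest N) : bimodKClosure N L ≤ bimodK N L := by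
  intro A hA
  set M := bimodKClosure N L with hMdef
  have hM : IsBimodule N M := hL.isBimodule_bimodKClosure hLc hN
  have hKL : IsWeaklyClosed (bimodKL N L) := isWeaklyClosed_wspan _
  have hKΔ : IsWeaklyClosed (bimodKDelta N L) := isWeaklyClosed_wspan _
  have hXmem := hN.proj_activeSpace_mem (M := M)
  set X := proj (activeSpace N M) with hX
  have hatom := hN.gap_orthogonal (E := fun P => P) (F := pred N) fun P Q h => le_pred h
  -- the columns of the active space
  obtain ⟨C, hC, hCA⟩ := exists_block_sum
    (E := fun P : N => gap (P : ClosedSubmodule ℂ H) (pred N P))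
    (F := fun P : N => gap ((edge N M P ⊓ pred N P : N) : ClosedSubmodule ℂ H)
      (edge N M (pred N P))) hatom
    (hN.gap_orthogonal (E := fun P => edge N M P ⊓ pred N P)
      fun P Q h => inf_le_left.trans (edge_mono (le_pred h)))
    (isWeaklyClosed_inf hKL (hKL.comap_mul 1 X)) A (fun P => by
      have hB := (hM _ (hM A hA _ (hN.proj_gap_mem P (pred N P))).2 _
        (hN.proj_gap_mem (edge N M P ⊓ pred N P) (edge N M (pred N P)))).1
      have hB1 : coproj (pred N P : ClosedSubmodule ℂ H) *
          proj (gap (P : ClosedSubmodule ℂ H) (pred N P)) =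
          proj (gap (P : ClosedSubmodule ℂ H) (pred N P)) := by
        rw [hN.proj_gap, ← mul_assoc, ← (commute_coproj_right (hN.commute_proj _ _)).eq, mul_assoc,
          coproj_mul_self]
      have hB2 : proj (gap ((edge N M P ⊓ pred N P : N) : ClosedSubmodule ℂ H)
          (edge N M (pred N P))) * proj (pred N P : ClosedSubmodule ℂ H) =
          proj (gap ((edge N M P ⊓ pred N P : N) : ClosedSubmodule ℂ H)
          (edge N M (pred N P))) := by
        rw [hN.proj_gap, mul_assoc, ← (commute_coproj_right (hN.commute_proj _ _)).eq, ← mul_assoc,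
          proj_mul_proj_of_le (inf_le_right : edge N M P ⊓ pred N P ≤ pred N P)]
      have hXp : X * proj (pred N P : ClosedSubmodule ℂ H) =
          proj (pred N P : ClosedSubmodule ℂ H) * X := (hN.commute_proj_activeSpace _).eq
      refine Submodule.mem_inf.2 ⟨?_, ?_⟩
      · have := hL.mem_bimodKL_of_closure hN (pred N P).2 hB
        rwa [← mul_assoc, ← mul_assoc, hB1, mul_assoc, hB2] at this
      · have := hL.mem_bimodKL_of_closure hN (pred N P).2 (hM _ hB _ hXmem).1
        rw [Submodule.mem_comap, LinearMap.mulLeftRight_apply, one_mul]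
        rwa [mul_assoc, mul_assoc _ X, hXp, ← mul_assoc _ _ X,
          mul_assoc _ _ (proj (pred N P : ClosedSubmodule ℂ H)), hB2, ← mul_assoc, ← mul_assoc, ← mul_assoc, hB1] at this)
  obtain ⟨hC1, hC2⟩ := Submodule.mem_inf.1 hC
  rw [Submodule.mem_comap, LinearMap.mulLeftRight_apply, one_mul] at hC2
  have hCM : C ∈ M := bimodK_le_bimodKClosure (bimodKL_le hC1)
  have hD : (A - C) * X ∈ bimodKD N L :=
    hN.mul_proj_activeSpace_mem hM (isWeaklyClosed_wspan _)
      (fun P hP T hT S hS => hL.mem_bimodKD_of_closure hN hP hT hS) hA hCM hCA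
  -- the remaining columns
  set U₀ := A * coproj (activeSpace N M) with hU₀
  have hU₀N : U₀ ∈ nestAlgebra N := hN.mul_coproj_activeSpace_mem hA
  have hU₀M : U₀ ∈ M := (hM A hA _ hN.coproj_activeSpace_mem).1
  obtain ⟨Δ, hΔ, hΔU⟩ := exists_block_sum
    (E := fun P : N => gap (P : ClosedSubmodule ℂ H) (pred N P))
    (F := fun P : N => gap (P : ClosedSubmodule ℂ H) (pred N P)) hatom hatom
    (isWeaklyClosed_inf hKΔ isWeaklyClosed_nestAlgebra) U₀ (fun B => by
      refine Submodule.mem_inf.2 ⟨?_, (Subalgebra.mem_toSubmodule _).2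
        (mul_mem (mul_mem (hN.proj_gap_mem _ _) hU₀N) (hN.proj_gap_mem _ _))⟩
      by_cases hB : B ≤ edge N M B
      · by_cases hB' : pred N B ≤ edge N M (pred N B)
        · have hz := atom_block_eq_zero B.2 (pred N B).2 (pred_le B)
            (fun P hP => by
              by_cases h : (⟨P, hP⟩ : N) < B
              · exact Or.inl (le_pred h)
              · exact Or.inr (hN.le_of_not_lt h))
            (fun T hT => coproj_mul_mul_proj_of_le_edge (M := M) hB hT)
            (fun T hT => coproj_mul_mul_proj_of_le_edge (M := M) hB' hT) hU₀M
          rw [← (commute_coproj_right (hN.commute_proj B (pred N B))).eq, ← hN.proj_gap] at hz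
          rw [hz]
          exact zero_mem _
        · exact hN.atom_block_mem hM hKΔ
            (fun P hP T hT S hS => hL.mem_bimodKDelta_of_closure hN hP hT hS) hB' U₀
      · have h1 : edge N M B ≤ pred N B := le_pred (hN.lt_of_not_le hB)
        have h2 : coproj (activeSpace N M) *
            proj (gap (B : ClosedSubmodule ℂ H) (pred N B)) = 0 :=
          coproj_mul_proj_of_le ((gap_mono h1).trans (gap_edge_le_activeSpace B))
        rw [hU₀, mul_assoc, mul_assoc, h2, mul_zero, mul_zero]
        exact zero_mem _)
  obtain ⟨hΔ1, hΔ2⟩ := Submodule.mem_inf.1 hΔ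
  have hV : U₀ - Δ ∈ bimodKV N L := by
    refine hN.mem_of_atom_blocks_eq_zero hM (isWeaklyClosed_wspan _)
      (fun P hP T hT => hL.mem_bimodKV_of_closure hN hP hT)
      (sub_mem hU₀M (bimodK_le_bimodKClosure (bimodKDelta_le hΔ1))) (sub_mem hU₀N hΔ2) fun B => ?_
    rw [mul_sub, sub_mul, hΔU, mul_assoc _ (proj _), proj_mul_self, sub_self]
  have hsum : A = (U₀ - Δ) + C * X + (A - C) * X + Δ := by
    rw [hU₀, coproj, sub_mul, mul_sub, mul_one]
    abel
  rw [hsum]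
  exact add_mem (add_mem (add_mem (bimodKV_le hV) (bimodKL_le hC2)) (bimodKD_le hD))
    (bimodKDelta_le hΔ1)

theorem IsLieModule.bimodKClosure_eq (hL : IsLieModule N L) (hLc : IsWeaklyClosed L)
    (hN : IsNest N) : bimodKClosure N L = bimodK N L :=
  le_antisymm (hL.bimodKClosure_le hLc hN) bimodK_le_bimodKClosure

end KClosed

variable {N : CompleteSublattice (ClosedSubmodule ℂ H)} {M K L : Submodule ℂ (H →L[ℂ] H)}

/-! ### Weakly closed bimodules -/

/-- The vectors `v` such that `u ⊗ v ∈ D`. -/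
def rankOneRange (D : Submodule ℂ (H →L[ℂ] H)) (hD : IsWeaklyClosed D) (u : H) :
    ClosedSubmodule ℂ H where
  carrier := {v | rankOne ℂ v u ∈ D}
  add_mem' {a b} ha hb := by
    simp only [Set.mem_ofPred_eq, map_add, add_apply] at *
    exact D.add_mem ha hb
  zero_mem' := by simp
  smul_mem' c v hv := by
    simp only [Set.mem_ofPred_eq, map_smul, smul_apply] at *
    exact D.smul_mem _ hv
  isClosed' := hD.isClosed.preimage
    ((rankOne ℂ : H →L[ℂ] H →L⋆[ℂ] H →L[ℂ] H).flip u).continuous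

lemma mem_rankOneRange {D : Submodule ℂ (H →L[ℂ] H)} {hD : IsWeaklyClosed D} {u v : H} :
    v ∈ rankOneRange D hD u ↔ rankOne ℂ v u ∈ D := Iff.rfl

/-- **Erdos–Power theorem**: every weakly closed bimodule `M` is associated with a left order
continuous homomorphism, namely `P ↦ ` the closed span of `M P`. -/
theorem IsNest.exists_isAssociated (hN : IsNest N) (hMc : IsWeaklyClosed M)
    (hM : IsBimodule N M) : ∃ φ : sSupHom N N, IsAssociated N φ M := by
  let X : N → Set H := fun P => {w | ∃ T ∈ M, ∃ z ∈ (P : ClosedSubmodule ℂ H), w = T z}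
  let V : N → ClosedSubmodule ℂ H := fun P => (Submodule.span ℂ (X P)).closure
  have hXV : ∀ P, ∀ w ∈ X P, w ∈ V P := fun P w hw => subset_closure (Submodule.subset_span hw)
  have hVle : ∀ {P} {Z : ClosedSubmodule ℂ H}, (∀ w ∈ X P, w ∈ Z) → V P ≤ Z := fun h =>
    Submodule.closure_le.2 (Submodule.span_le.2 h)
  have hVN : ∀ P, V P ∈ N := fun P => hN.mem_of_invariant _ fun S hS v hv => by
    have : V P ≤ (V P).comap S := hVle fun w ⟨T, hT, z, hz, hw⟩ => by
      rw [ClosedSubmodule.mem_comap, hw]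
      exact hXV P _ ⟨S * T, (hM T hT S hS).2, z, hz, rfl⟩
    exact this hv
  let φ : N → N := fun P => ⟨V P, hVN P⟩
  have hφ : ∀ P : N, ∀ T ∈ M, (P : ClosedSubmodule ℂ H) ≤ (φ P : ClosedSubmodule ℂ H).comap T :=
    fun P T hT z hz => hXV P _ ⟨T, hT, z, hz, rfl⟩
  refine ⟨⟨φ, fun S => le_antisymm ?_ (sSup_le ?_)⟩, fun T => ⟨fun hT P => ?_, fun h => ?_⟩⟩
  · refine hVle (P := sSup S) fun w ⟨T, hT, z, hz, hw⟩ => ?_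
    have : ((sSup S : N) : ClosedSubmodule ℂ H) ≤
        ((sSup (φ '' S) : N) : ClosedSubmodule ℂ H).comap T := coe_sSup_le fun Q hQ x hx =>
      (le_sSup ⟨Q, hQ, rfl⟩ : φ Q ≤ sSup (φ '' S)) (hφ Q T hT hx)
    rw [hw]
    exact this hz
  · rintro _ ⟨Q, hQ, rfl⟩
    refine hVle (P := Q) fun w ⟨T, hT, z, hz, hw⟩ => ?_
    exact hXV _ _ ⟨T, hT, z, (le_sSup hQ : Q ≤ sSup S) hz, hw⟩
  · ext x
    exact coproj_apply_eq_zero_iff.2 (hφ P T hT (proj_apply_mem _ x))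
  · refine hN.mem_of_rankOne_right hMc fun P x y hy hx => ?_
    have hTy : T y ∈ V P := by
      have := DFunLike.congr_fun (h P) y
      rw [mul_apply_eq_comp, mul_apply_eq_comp, proj_apply_of_mem hy] at this
      exact coproj_apply_eq_zero_iff.1 this
    have : V P ≤ rankOneRange M hMc x := hVle fun w ⟨S, hS, z, hz, hw⟩ => by
      rw [mem_rankOneRange, hw, ← mul_rankOne]
      exact (hM S hS _ (hN.rankOne_mem hz hx)).1
    exact this hTy

/-- The bimodule generated by `x ⊗ y` contains all of `P_y B(H) \hat P_x^⊥`. -/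
lemma IsNest.corner_mem_of_rankOne_mem (hN : IsNest N) (hMc : IsWeaklyClosed M)
    (hM : IsBimodule N M) {x y : H} (h : rankOne ℂ y x ∈ M) (T : H →L[ℂ] H) :
    proj (lowerProj N y : ClosedSubmodule ℂ H) * T *
      coproj (upperProj N x : ClosedSubmodule ℂ H) ∈ M := by
  suffices h' : ∀ u v, proj (lowerProj N y : ClosedSubmodule ℂ H) * rankOne ℂ v u *
      coproj (upperProj N x : ClosedSubmodule ℂ H) ∈ M from hMc.mul_mul_mem h' T
  intro u v
  rw [mul_rankOne, rankOne_mul, adjoint_coproj]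
  set v' := proj (lowerProj N y : ClosedSubmodule ℂ H) v
  have h1 : rankOneRange M hMc x ∈ N := hN.mem_of_invariant _ fun S hS w hw => by
    rw [mem_rankOneRange, ← mul_rankOne]
    exact (hM _ hw S hS).2
  have hv' : rankOne ℂ v' x ∈ M :=
    (lowerProj_le (Q := ⟨_, h1⟩) h : lowerProj N y ≤ _) (proj_apply_mem _ v)
  obtain ⟨W, hW⟩ := hN.exists_of_adjoint_invariant (rankOneSlice M hMc v') fun S hS w hw => by
    rw [mem_rankOneSlice, ← rankOne_mul]
    exact (hM _ hw S hS).1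
  refine (hW _).2 ?_
  rw [← mul_apply_eq_comp, proj_mul_coproj_of_le (le_upperProj ((hW x).1 hv')), zero_apply]

/-! ### The bimodule `J(L)` -/

lemma bimodJ_eq_wspan_cornerSet : bimodJ N L = wspan (cornerSet N L) := by
  refine le_antisymm (wspan_le (isWeaklyClosed_wspan _) ?_) (wspan_le (isWeaklyClosed_wspan _) ?_)
  · rintro _ ⟨x, y, rfl, h⟩
    refine subset_wspan _ ⟨_, (upperProj N x).2, _, (lowerProj N y).2, h, rankOne ℂ y x, ?_⟩
    rw [mul_rankOne, rankOne_mul, adjoint_coproj, proj_apply_of_mem (mem_lowerProj y),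
      coproj_apply_eq_self_iff.2 (proj_upperProj x)]
  · rintro _ ⟨P, hP, Q, hQ, h, T, rfl⟩
    refine (isWeaklyClosed_wspan _).mul_mul_mem (fun x y => subset_wspan _ ?_) T
    rw [mul_rankOne, rankOne_mul, adjoint_coproj]
    refine ⟨_, _, rfl, fun S => ?_⟩
    have h1 : lowerProj N (proj Q y) ≤ ⟨Q, hQ⟩ := lowerProj_le (proj_apply_mem Q y)
    have h2 : (⟨P, hP⟩ : N) ≤ upperProj N (coproj P x) := le_upperProj (proj_coproj_apply P x)
    have h1' : (lowerProj N (proj Q y) : ClosedSubmodule ℂ H) ≤ Q := h1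
    have h2' : P ≤ (upperProj N (coproj P x) : ClosedSubmodule ℂ H) := h2
    have := h (proj (lowerProj N (proj Q y) : ClosedSubmodule ℂ H) * S *
      coproj (upperProj N (coproj P x) : ClosedSubmodule ℂ H))
    rwa [← mul_assoc, ← mul_assoc, proj_mul_proj_of_ge h1', mul_assoc,
      coproj_mul_coproj_of_ge h2'] at this

lemma isBimodule_bimodJ : IsBimodule N (bimodJ N L) := by
  intro A hA S hS
  rw [bimodJ_eq_wspan_cornerSet] at hA ⊢
  constructor
  · refine mul_right_mem_of_mem_wspan (isWeaklyClosed_wspan _) S ?_ hA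
    rintro _ ⟨P, hP, Q, hQ, h, T, rfl⟩
    refine subset_wspan _ ⟨P, hP, Q, hQ, h, T * (coproj P * S), ?_⟩
    rw [mul_assoc _ _ S, coproj_mul_of_mem_nestAlgebra hS ⟨P, hP⟩]
    simp only [mul_assoc, coproj_mul_self]
  · refine mul_left_mem_of_mem_wspan (isWeaklyClosed_wspan _) S ?_ hA
    rintro _ ⟨P, hP, Q, hQ, h, T, rfl⟩
    refine subset_wspan _ ⟨P, hP, Q, hQ, h, S * proj Q * T, ?_⟩
    simp only [mul_assoc]
    exact mul_proj_mul_of_mem_nestAlgebra hS ⟨Q, hQ⟩ _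

lemma bimodJ_le (hLc : IsWeaklyClosed L) : bimodJ N L ≤ L := by
  rw [bimodJ_eq_wspan_cornerSet]
  refine wspan_le hLc ?_
  rintro _ ⟨P, hP, Q, hQ, h, T, rfl⟩
  exact h T

/-- A weakly closed bimodule is generated by its rank one operators, so it lies in `J(L)` as soon as
it lies in `L`. -/
theorem IsNest.le_bimodJ (hN : IsNest N) (hMc : IsWeaklyClosed M) (hM : IsBimodule N M)
    (hML : M ≤ L) : M ≤ bimodJ N L := fun A hA => by
  refine hN.mem_of_rankOne_right (isWeaklyClosed_wspan _) fun P x y hy hx => subset_wspan _ ?_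
  refine ⟨x, A y, rfl, fun T => hML (hN.corner_mem_of_rankOne_mem hMc hM ?_ T)⟩
  rw [← mul_rankOne]
  exact (hM A hA _ (hN.rankOne_mem hy hx)).1

/-! ### The diagonal part of `L` -/

lemma mem_diagonal_iff {T : H →L[ℂ] H} :
    T ∈ diagonal N ↔ ∀ P : N, Commute T (proj (P : ClosedSubmodule ℂ H)) := by
  constructor
  · rintro ⟨h1, h2⟩ P
    have h3 := mul_proj_of_mem_nestAlgebra h1 P
    have h4 := congrArg star (mul_proj_of_mem_nestAlgebra h2 P)
    simp only [star_mul, star_proj, star_star] at h4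
    rw [mul_assoc] at h4
    exact h3.trans h4.symm
  · intro h
    refine ⟨mem_nestAlgebra_of_commute h, mem_nestAlgebra_of_commute fun P => ?_⟩
    have := (h P).star_star
    rwa [star_proj] at this

/-- The symmetry `2 P - 1`. -/
lemma two_proj_sub_one_mem_unitary (P : ClosedSubmodule ℂ H) :
    (2 : ℂ) • proj P - 1 ∈ unitary (H →L[ℂ] H) := by
  have h1 : star ((2 : ℂ) • proj P - 1) = (2 : ℂ) • proj P - 1 := by
    rw [star_sub, star_smul, star_proj, star_one]
    simp
  have h2 : ((2 : ℂ) • proj P - 1) * ((2 : ℂ) • proj P - 1) = 1 := by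
    simp only [mul_sub, sub_mul, smul_mul_assoc, mul_smul_comm, proj_mul_self, mul_one, one_mul]
    module
  rw [Unitary.mem_iff, h1]
  exact ⟨h2, h2⟩

/-- If all the commutators of `T` with the nest lie in the weakly closed bimodule `K`, then `T` is
the sum of an element of `K` and one of the diagonal: the averages of `T` over finite sets of
symmetries `2 P - 1` stay bounded and differ from `T` by elements of `K`. -/
theorem IsNest.exists_mem_diagonal (hN : IsNest N) (hKc : IsWeaklyClosed K) (hK : IsBimodule N K)
    {T : H →L[ℂ] H} (hT : ∀ P : N, T * proj (P : ClosedSubmodule ℂ H) -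
      proj (P : ClosedSubmodule ℂ H) * T ∈ K) :
    ∃ B ∈ diagonal N, T - B ∈ K := by
  classical
  have hfin : ∀ s : Finset N, ∃ B : H →L[ℂ] H, ‖B‖ ≤ ‖T‖ ∧ T - B ∈ K ∧
      ∀ P ∈ s, Commute B (proj (P : ClosedSubmodule ℂ H)) := by
    intro s
    induction s using Finset.induction_on with
    | empty => exact ⟨T, le_rfl, by simp, by simp⟩
    | insert P s _ ih =>
      obtain ⟨B, hB, hTB, hBs⟩ := ih
      set p := proj (P : ClosedSubmodule ℂ H) with hp
      set u : H →L[ℂ] H := (2 : ℂ) • p - 1 with hu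
      have hpp : p * p = p := proj_mul_self _
      have huU : u ∈ unitary (H →L[ℂ] H) := two_proj_sub_one_mem_unitary _
      have huN : u ∈ nestAlgebra N :=
        sub_mem (Subalgebra.smul_mem _ (hN.proj_mem P) _) (one_mem _)
      have hBp : B * p - p * B ∈ K := by
        have h1 := hK _ hTB _ (hN.proj_mem P)
        have h2 := K.sub_mem (hT P) (K.sub_mem h1.1 h1.2)
        convert h2 using 1
        rw [sub_mul, mul_sub]
        abel
      refine ⟨(1 / 2 : ℂ) • (B + u * B * u), ?_, ?_, fun Q hQ => ?_⟩
      · have h1 : ‖u * B * u‖ = ‖B‖ := by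
          rw [CStarRing.norm_mul_mem_unitary _ huU, CStarRing.norm_mem_unitary_mul _ huU]
        calc ‖(1 / 2 : ℂ) • (B + u * B * u)‖ ≤ ‖(1 / 2 : ℂ)‖ * ‖B + u * B * u‖ := norm_smul_le _ _
          _ ≤ (1 / 2) * (‖B‖ + ‖B‖) := by
              have : ‖(1 / 2 : ℂ)‖ = 1 / 2 := by norm_num
              rw [this]
              gcongr
              exact (norm_add_le _ _).trans_eq (by rw [h1])
          _ ≤ ‖T‖ := by linarith
      · have h1 := K.add_mem hTB (hK _ hBp _ huN).1
        convert h1 using 1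
        have h2 : u * B * u = (2 : ℂ) • (p * B * u) - B * u := by
          rw [hu]
          simp only [sub_mul, smul_mul_assoc, one_mul]
        have h3 : B * p * u = B * p := by
          rw [hu]
          simp only [mul_sub, mul_smul_comm, mul_assoc, hpp, mul_one]
          module
        have h4 : B * u = (2 : ℂ) • (B * p) - B := by
          rw [hu]
          simp only [mul_sub, mul_smul_comm, mul_one]
        rw [h2, sub_mul, h3, h4]
        module
      · rcases Finset.mem_insert.1 hQ with rfl | hQ
        · have h1 : u * p = p := by
            rw [hu]
            simp only [sub_mul, smul_mul_assoc, hpp, one_mul]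
            module
          have h2 : p * u = p := by
            rw [hu]
            simp only [mul_sub, mul_smul_comm, hpp, mul_one]
            module
          change _ * p = p * _
          rw [smul_mul_assoc, mul_smul_comm, add_mul, mul_add, mul_assoc _ u p, h1, mul_assoc u,
            ← mul_assoc p, ← mul_assoc p u, h2]
          congr 1
          have h5 : u * (B * p) = (2 : ℂ) • (p * (B * p)) - B * p := by
            rw [hu]
            simp only [sub_mul, smul_mul_assoc, one_mul]
          have h6 : p * B * u = (2 : ℂ) • (p * (B * p)) - p * B := by
            rw [hu]
            simp only [mul_sub, mul_smul_comm, mul_one, mul_assoc]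
          rw [h5, h6]
          abel
        · have h1 : Commute u (proj (Q : ClosedSubmodule ℂ H)) :=
            ((hN.commute_proj P Q).smul_left _).sub_left (Commute.one_left _)
          exact ((hBs Q hQ).add_left ((h1.mul_left (hBs Q hQ)).mul_left h1)).smul_left _
  choose B hB hTB hBs using hfin
  let U : Ultrafilter (Finset N) := Ultrafilter.of atTop
  obtain ⟨B₀, hB₀⟩ := exists_wot_limit U B hB
  refine ⟨B₀, mem_diagonal_iff.2 fun P => ?_, ?_⟩
  · ext y
    refine ext_inner_left ℂ fun x => ?_
    rw [mul_apply_eq_comp, mul_apply_eq_comp, ← inner_proj_left]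
    refine tendsto_nhds_unique (hB₀ _ _) ((hB₀ _ _).congr' ?_)
    have hev : ∀ᶠ s in (U : Filter (Finset N)), P ∈ s :=
      (Ultrafilter.of_le atTop) ((eventually_ge_atTop {P}).mono fun s hs => by simpa using hs)
    refine hev.mono fun s hs => ?_
    change ⟪proj (P : ClosedSubmodule ℂ H) x, B s y⟫_ℂ =
      ⟪x, B s (proj (P : ClosedSubmodule ℂ H) y)⟫_ℂ
    rw [inner_proj_left, ← mul_apply_eq_comp, ← mul_apply_eq_comp, (hBs s P hs).eq]
  · refine hKc.mem_of_tendsto (U := (U : Filter (Finset N))) (T := fun s => T - B s)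
      (fun x y => ?_) (Eventually.of_forall hTB)
    simp only [sub_apply, inner_sub_right]
    exact tendsto_const_nhds.sub (hB₀ x y)

lemma IsNest.proj_sub_proj (hN : IsNest N) {P Q : N} (h : Q ≤ P) :
    proj (P : ClosedSubmodule ℂ H) - proj (Q : ClosedSubmodule ℂ H) =
      proj (gap (P : ClosedSubmodule ℂ H) Q) := by
  rw [hN.proj_gap, coproj, mul_sub, mul_one, proj_mul_proj_of_ge h]

lemma apply_mem_gap_of_mem_diagonal {B : H →L[ℂ] H} (hB : B ∈ diagonal N) {P Q : N} {x : H}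
    (hx : x ∈ gap (P : ClosedSubmodule ℂ H) Q) : B x ∈ gap (P : ClosedSubmodule ℂ H) Q := by
  obtain ⟨h1, h2⟩ := mem_gap.1 hx
  refine mem_gap.2 ⟨hB.1 P P.2 x h1, ?_⟩
  rw [← mul_apply_eq_comp, ← (mem_diagonal_iff.1 hB Q).eq, mul_apply_eq_comp, h2, map_zero]

lemma exists_mem_gap_ne_zero {P Q : ClosedSubmodule ℂ H} (h : Q < P) :
    ∃ x ∈ gap P Q, x ≠ 0 := by
  obtain ⟨x, hx, hxQ⟩ := SetLike.exists_of_lt h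
  refine ⟨coproj Q x, mem_gap.2 ⟨?_, proj_coproj_apply _ _⟩,
    fun h0 => hxQ (coproj_apply_eq_zero_iff.1 h0)⟩
  exact P.toSubmodule.sub_mem hx (h.le (proj_apply_mem Q x))

/-- A diagonal operator `B` with `[B, T(N)] ⊆ L` acts as a scalar on `P - φ(P)` whenever the nest
has an element `Q` strictly between `φ(P)` and `P`: for `v ∈ Q - φ(P)` and `u ∈ P - Q`, the
commutator of `B` with `u ⊗ v` belongs to `K(L)`, which has no corner there, so `B` commutes with
`u ⊗ v`. -/
theorem IsNest.mem_diagD (hN : IsNest N) {φ : sSupHom N N} (hφ : IsAssociated N φ (bimodK N L))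
    {B : H →L[ℂ] H} (hB : B ∈ diagonal N) (hBL : ∀ S ∈ nestAlgebra N, B * S - S * B ∈ L) :
    B ∈ diagD N φ := by
  refine ⟨hB, fun P hP => ?_⟩
  obtain ⟨Q, hQ1, hQ2⟩ := hN.lt_of_lt_pred hP
  have key : ∀ v ∈ gap (Q : ClosedSubmodule ℂ H) (φ P), ∀ u ∈ gap (P : ClosedSubmodule ℂ H) Q,
      ∀ z, ⟪u, z⟫_ℂ • B v = ⟪u, B z⟫_ℂ • v := by
    intro v hv u hu
    obtain ⟨hv1, hv2⟩ := mem_gap.1 hv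
    obtain ⟨hu1, hu2⟩ := mem_gap.1 hu
    obtain ⟨hBv1, hBv2⟩ := mem_gap.1 (apply_mem_gap_of_mem_diagonal hB hv)
    have hB' : star B ∈ diagonal N := ⟨hB.2, by rw [star_star]; exact hB.1⟩
    obtain ⟨hBu1, hBu2⟩ := mem_gap.1 (apply_mem_gap_of_mem_diagonal hB' hu)
    rw [ContinuousLinearMap.star_eq_adjoint] at hBu1 hBu2
    have hS : rankOne ℂ v u ∈ nestAlgebra N := hN.rankOne_mem hv1
      (proj_apply_eq_zero_iff.2 fun z hz => proj_apply_eq_zero_iff.1 hu2 z (pred_le Q hz))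
    have h1 := (hφ _).1 (bimodKV_le (mem_bimodKV Q.2 (hBL _ hS))) P
    simp only [mul_rankOne, rankOne_mul, mul_sub, sub_mul, adjoint_coproj, adjoint_proj,
      proj_apply_of_mem hv1, proj_apply_of_mem hBv1, coproj_apply_eq_self_iff.2 hv2,
      coproj_apply_eq_self_iff.2 hBv2, coproj_apply_eq_self_iff.2 hu2,
      coproj_apply_eq_self_iff.2 hBu2, proj_apply_of_mem hu1, proj_apply_of_mem hBu1] at h1
    intro z
    have h2 := DFunLike.congr_fun h1 z
    simp only [sub_apply, rankOne_apply, zero_apply,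
      ContinuousLinearMap.adjoint_inner_left] at h2
    exact sub_eq_zero.1 h2
  obtain ⟨v₀, hv₀, hv₀'⟩ := exists_mem_gap_ne_zero (P := (Q : ClosedSubmodule ℂ H)) hQ1
  obtain ⟨u₀, hu₀, hu₀'⟩ := exists_mem_gap_ne_zero (P := (P : ClosedSubmodule ℂ H)) hQ2
  have hu₀'' : ⟪u₀, u₀⟫_ℂ ≠ 0 := inner_self_ne_zero.2 hu₀'
  set c : ℂ := (⟪u₀, u₀⟫_ℂ)⁻¹ * ⟪u₀, B u₀⟫_ℂ with hc
  have hQ : ∀ v ∈ gap (Q : ClosedSubmodule ℂ H) (φ P), B v = c • v := fun v hv => by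
    rw [hc, mul_smul, ← key v hv u₀ hu₀ u₀, smul_smul, inv_mul_cancel₀ hu₀'', one_smul]
  have hP' : ∀ u ∈ gap (P : ClosedSubmodule ℂ H) Q, B u = c • u := fun u hu => by
    have h1 : B u - c • u ∈ gap (P : ClosedSubmodule ℂ H) Q :=
      (gap (P : ClosedSubmodule ℂ H) Q).toSubmodule.sub_mem (apply_mem_gap_of_mem_diagonal hB hu)
        ((gap (P : ClosedSubmodule ℂ H) Q).toSubmodule.smul_mem c hu)
    rw [← sub_eq_zero, ← inner_self_eq_zero (𝕜 := ℂ)]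
    have h2 := key v₀ hv₀ _ h1 u
    rw [hQ v₀ hv₀, smul_smul] at h2
    have h3 := smul_left_injective ℂ hv₀' h2
    rw [inner_sub_right (B u - c • u), inner_smul_right, ← h3]
    ring
  refine ⟨c, ?_⟩
  have hsplit : proj (P : ClosedSubmodule ℂ H) - proj (φ P : ClosedSubmodule ℂ H) =
      proj (gap (P : ClosedSubmodule ℂ H) Q) + proj (gap (Q : ClosedSubmodule ℂ H) (φ P)) := by
    rw [← hN.proj_sub_proj hQ2.le, ← hN.proj_sub_proj hQ1.le, sub_add_sub_cancel]
  rw [hsplit]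
  ext x
  simp only [mul_apply_eq_comp, add_apply, smul_apply, map_add, smul_add]
  rw [hP' _ (proj_apply_mem _ x), hQ _ (proj_apply_mem _ x)]

/-- `D_K` is the commutant of the projections of the nest together with the algebras `E B(H) E`,
`E = P - φ(P)`, on which its elements act as scalars. -/
theorem exists_vonNeumannAlgebra_eq_diagD (φ : sSupHom N N) :
    ∃ D : VonNeumannAlgebra H, (D : Set (H →L[ℂ] H)) = diagD N φ := by
  let E : N → H →L[ℂ] H := fun P =>
    proj (P : ClosedSubmodule ℂ H) - proj (φ P : ClosedSubmodule ℂ H)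
  have hEs : ∀ P, star (E P) = E P := fun P => by simp [E]
  let S : Set (H →L[ℂ] H) := {A | ∃ P : N, A = proj (P : ClosedSubmodule ℂ H)} ∪
    {A | ∃ P : N, φ P < pred N P ∧ ∃ C, A = E P * C * E P}
  have hS : star S = S := by
    have h : ∀ A ∈ S, star A ∈ S := by
      rintro _ (⟨P, rfl⟩ | ⟨P, hP, C, rfl⟩)
      · exact Or.inl ⟨P, star_proj _⟩
      · refine Or.inr ⟨P, hP, star C, ?_⟩
        rw [star_mul, star_mul, hEs, mul_assoc]
    exact Set.Subset.antisymm (fun A hA => by simpa using h _ hA) fun A hA => h A hA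
  let D : VonNeumannAlgebra H := ⟨StarSubalgebra.centralizer ℂ S, by
    change Set.centralizer (Set.centralizer ((StarSubalgebra.centralizer ℂ S : Set (H →L[ℂ] H)))) =
      (StarSubalgebra.centralizer ℂ S : Set (H →L[ℂ] H))
    rw [StarSubalgebra.coe_centralizer, Set.centralizer_centralizer_centralizer]⟩
  have hD : (D : Set (H →L[ℂ] H)) = Set.centralizer S := by
    change (StarSubalgebra.centralizer ℂ S : Set (H →L[ℂ] H)) = _
    rw [StarSubalgebra.coe_centralizer, hS, Set.union_self]
  refine ⟨D, hD.trans (Set.ext fun T => ?_)⟩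
  rw [Set.mem_centralizer_iff]
  constructor
  · intro h
    refine ⟨mem_diagonal_iff.2 fun P => (h _ (Or.inl ⟨P, rfl⟩)).symm, fun P hP => ?_⟩
    change ∃ c : ℂ, T * E P = c • E P
    have hP' : φ P ≤ P := hP.le.trans (pred_le P)
    have hEE : E P * E P = E P := by
      simp only [E, mul_sub, sub_mul, proj_mul_self, proj_mul_proj_of_le hP',
        proj_mul_proj_of_ge hP', sub_self, sub_zero]
    by_cases h0 : E P = 0
    · exact ⟨0, by rw [h0]; simp⟩
    obtain ⟨w, hw⟩ : ∃ w, E P w ≠ 0 := by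
      by_contra! h1
      exact h0 (ContinuousLinearMap.ext h1)
    set e := E P w with he
    have hEe : E P e = e := by rw [he, ← mul_apply_eq_comp, hEE]
    have hee : ⟪e, e⟫_ℂ ≠ 0 := inner_self_ne_zero.2 hw
    refine ⟨(⟪e, e⟫_ℂ)⁻¹ * ⟪e, T e⟫_ℂ, ContinuousLinearMap.ext fun x => ?_⟩
    have h1 := DFunLike.congr_fun (h _ (Or.inr ⟨P, hP, rankOne ℂ x e, rfl⟩)) e
    have h2 : E P * rankOne ℂ x e * E P = rankOne ℂ (E P x) e := by
      rw [mul_rankOne, rankOne_mul, ← ContinuousLinearMap.star_eq_adjoint, hEs, hEe]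
    rw [h2] at h1
    simp only [mul_apply_eq_comp, rankOne_apply, map_smul] at h1
    rw [mul_apply_eq_comp, smul_apply, mul_smul, h1, smul_smul, inv_mul_cancel₀ hee, one_smul]
  · rintro ⟨hT, hTE⟩ _ (⟨P, rfl⟩ | ⟨P, hP, C, rfl⟩)
    · exact ((mem_diagonal_iff.1 hT P).eq).symm
    · obtain ⟨c, hc⟩ := hTE P hP
      change T * E P = c • E P at hc
      have h1 : E P * T = T * E P := by
        have := ((mem_diagonal_iff.1 hT P).sub_right (mem_diagonal_iff.1 hT (φ P))).eq
        exact this.symm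
      rw [mul_assoc, h1, hc, ← mul_assoc, ← mul_assoc, hc]
      simp only [smul_mul_assoc, mul_smul_comm]

lemma commutator_proj_mem_bimodK {T : H →L[ℂ] H}
    (hT : T ∈ L) (P : N) : T * proj (P : ClosedSubmodule ℂ H) -
      proj (P : ClosedSubmodule ℂ H) * T ∈ bimodK N L := by
  convert sub_mem (bimodKL_le (mem_bimodKL P.2 hT)) (bimodKV_le (mem_bimodKV P.2 hT)) using 1
  simp only [coproj, sub_mul, mul_sub, one_mul, mul_one]
  abel

end NestAlg

end

theorem theorem3 {H : Type*} [NormedAddCommGroup H] [InnerProductSpace ℂ H] [CompleteSpace H]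
    (N : CompleteSublattice (ClosedSubmodule ℂ H)) (hN : NestAlg.IsNest N)
    (L : Submodule ℂ (H →L[ℂ] H)) (hLc : NestAlg.IsWeaklyClosed L)
    (hL : NestAlg.IsLieModule N L) :
    -- `J(L)` and `K(L)` are weakly closed bimodules
    (NestAlg.IsWeaklyClosed (NestAlg.bimodJ N L) ∧ NestAlg.IsBimodule N (NestAlg.bimodJ N L)) ∧
    (NestAlg.IsWeaklyClosed (NestAlg.bimodK N L) ∧ NestAlg.IsBimodule N (NestAlg.bimodK N L)) ∧
    -- `D_{K(L)}` is defined, is a von Neumann subalgebra of the diagonal, and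
    -- `L ⊆ K(L) + D_{K(L)}`
    (∃ φ : sSupHom N N, NestAlg.IsAssociated N φ (NestAlg.bimodK N L)) ∧
    (∀ φ : sSupHom N N, NestAlg.IsAssociated N φ (NestAlg.bimodK N L) →
      ∃ D : VonNeumannAlgebra H,
        (D : Set (H →L[ℂ] H)) = NestAlg.diagD N φ ∧
        (D : Set (H →L[ℂ] H)) ⊆ NestAlg.diagonal N ∧
        ∀ T ∈ L, ∃ A ∈ NestAlg.bimodK N L, ∃ B ∈ D, T = A + B) ∧
    -- `J(L) ⊆ L`
    NestAlg.bimodJ N L ≤ L ∧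
    -- the description of `J(L)`, and its maximality
    NestAlg.bimodJ N L = NestAlg.wspan (NestAlg.cornerSet N L) ∧
    IsGreatest {M : Submodule ℂ (H →L[ℂ] H) |
      NestAlg.IsWeaklyClosed M ∧ NestAlg.IsBimodule N M ∧ M ≤ L} (NestAlg.bimodJ N L) ∧
    -- `[K(L), T(N)] ⊆ L`
    (∀ T ∈ NestAlg.bimodK N L, ∀ S ∈ NestAlg.nestAlgebra N, T * S - S * T ∈ L) := by
  have hJc : NestAlg.IsWeaklyClosed (NestAlg.bimodJ N L) := NestAlg.isWeaklyClosed_wspan _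
  have hKc : NestAlg.IsWeaklyClosed (NestAlg.bimodK N L) := by
    rw [← hL.bimodKClosure_eq hLc hN]
    exact NestAlg.isWeaklyClosed_wspan _
  have hKb : NestAlg.IsBimodule N (NestAlg.bimodK N L) := by
    rw [← hL.bimodKClosure_eq hLc hN]
    exact hL.isBimodule_bimodKClosure hLc hN
  refine ⟨⟨hJc, NestAlg.isBimodule_bimodJ⟩, ⟨hKc, hKb⟩, hN.exists_isAssociated hKc hKb,
    fun φ hφ => ?_, NestAlg.bimodJ_le hLc, NestAlg.bimodJ_eq_wspan_cornerSet,
    ⟨⟨hJc, NestAlg.isBimodule_bimodJ, NestAlg.bimodJ_le hLc⟩,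
      fun M hM => hN.le_bimodJ hM.1 hM.2.1 hM.2.2⟩,
    fun T hT S hS => hL.commutator_bimodK_mem hLc hN hT hS⟩
  obtain ⟨D, hD⟩ := NestAlg.exists_vonNeumannAlgebra_eq_diagD φ
  refine ⟨D, hD, hD ▸ fun B hB => hB.1, fun T hT => ?_⟩
  obtain ⟨B, hB, hTB⟩ := hN.exists_mem_diagonal hKc hKb (NestAlg.commutator_proj_mem_bimodK hT)
  refine ⟨T - B, hTB, B, ?_, (sub_add_cancel T B).symm⟩
  change B ∈ (D : Set (H →L[ℂ] H))
  rw [hD]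
  refine hN.mem_diagD hφ hB fun S hS => ?_
  -- `[B, S] = [T, S] - [T - B, S]`
  convert L.sub_mem (hL T hT S hS) (hL.commutator_bimodK_mem hLc hN hTB hS) using 1
  rw [sub_mul, mul_sub]
  abel
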